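/- Consider a randomized word RAM with word size $w$: it stores words in $\{0,\dots,2^w-1\}$ in registers and word-indexed arrays, performs each elementary operation (word arithmetic, comparison, array access, reading one character of the input string, drawing one fair random bit, branching) in unit time, and draws independent random bits. There exist two fixed programs, a preprocessing program $P$ and a query program $Q$, and a constant $C$ such that the following holds for all integers $n,k\ge 1$, every word size $w$ with $2^w\ge (n+2)^C$ and $2^w>k$ (so words of $O(\log n)$ bits suffice when $k$ is polynomial in $n$), every alphabet $\Sigma$ whose characters are encoded by distinct $w$-bit words, and all strings $A=a_1\cdots a_n$ and $B=b_1\cdots b_n$ over $\Sigma$. The program $P$ is given only $n$, $k$ and $B$; the program $Q$ is then given $n$, $k$, $A$ and the arrays left in memory by $P$, and outputs a bit. Let $\mathrm{ED}(A,B)$ denote the minimum number of character insertions, deletions and substitutions needed to convert $A$ into $B$. 1. (Time.) For every outcome of the random bits, $P$ halts within $C\,n\,\log^C(n+2)=\tilde O(n)$ steps, and $Q$ halts within $C\left(\frac nk+k^2\right)\log^C(n+2)=\tilde O\!\left(\frac nk+k^2\right)$ steps. 2. (Correctness.) With probability at least $1-\frac1n$ over the random bits used by $P$ and $Q$, the output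 of $Q$ is $1$ (YES) if $\mathrm{ED}(A,B)\le k$, and $0$ (NO) if $\mathrm{ED}(A,B)>3k^2$. (If $k<\mathrm{ED}(A,B)\le 3k^2$, either output is allowed.) -/

import Mathlib

namespace GapEdit

/-! ### Edit distance -/

/-- `EditStep u v`: the string `v` is obtained from `u` by one insertion, one deletion or one
substitution of a character. -/
inductive EditStep {α : Type*} : List α → List α → Prop
  | ins (u v : List α) (a : α) : EditStep (u ++ v) (u ++ a :: v)
  | del (u v : List α) (a : α) : EditStep (u ++ a :: v) (u ++ v)
  | sub (u v : List α) (a b : α) : EditStep (u ++ a :: v) (u ++ b :: v)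

/-- `EditSteps m u v`: `v` is obtained from `u` by a sequence of exactly `m` edit steps. -/
inductive EditSteps {α : Type*} : ℕ → List α → List α → Prop
  | refl (u : List α) : EditSteps 0 u u
  | step {m : ℕ} {u v x : List α} : EditStep u v → EditSteps m v x → EditSteps (m + 1) u x

/-- Any string can be converted into any other one, so the infimum in `editDist` is a minimum. -/
theorem exists_editSteps {α : Type*} (u v : List α) : ∃ m, EditSteps m u v := by
  induction u with
  | nil =>
    induction v with
    | nil => exact ⟨0, .refl _⟩
    | cons a v ih =>
      have hcons : ∀ (m : ℕ) (p q : List α), EditSteps m p q → EditSteps (m + 1) p (a :: q) := by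
        intro m p q h
        induction h with
        | refl p => exact .step (.ins [] p a) (.refl _)
        | step hs _ ih' => exact .step hs ih'
      obtain ⟨m, hm⟩ := ih
      exact ⟨m + 1, hcons m _ _ hm⟩
  | cons a u ih =>
    obtain ⟨m, hm⟩ := ih
    exact ⟨m + 1, .step (.del [] u a) hm⟩

/-- The edit distance `ED(u, v)`: the minimum number of character insertions, deletions and
substitutions needed for converting `u` into `v`. -/
noncomputable def editDist {α : Type*} (u v : List α) : ℕ := sInf {m | EditSteps m u v}

/-! ### A randomized word RAM

Programs are finite syntax trees. The store of a program consists of word-sized registers (`var`),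
of word-indexed arrays of words (`arr`) and of the position on a tape of random bits (`pos`).
Registers and arrays are named by literals of the program text, so that every program uses only
finitely many of each. Every elementary operation takes one unit of time. -/

/-- Binary operations on machine words. -/
inductive Op
  | add | sub | mul | div | mod | lt | eq

/-- Arithmetic on `w`-bit words, i.e. on `{0, …, 2 ^ w - 1}`, with wrap-around. Comparisons return
`1` for true and `0` for false. -/
def Op.eval (w : ℕ) : Op → ℕ → ℕ → ℕ
  | .add, a, b => (a + b) % 2 ^ w
  | .sub, a, b => (a + (2 ^ w - b)) % 2 ^ w
  | .mul, a, b => (a * b) % 2 ^ w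
  | .div, a, b => a / b
  | .mod, a, b => a % b
  | .lt, a, b => if a < b then 1 % 2 ^ w else 0
  | .eq, a, b => if a = b then 1 % 2 ^ w else 0

/-- Expressions: literals, registers, array reads, reads of one character of the read-only input
string, and binary operations. -/
inductive Expr
  | lit (c : ℕ)
  | var (x : ℕ)
  | arr (a : ℕ) (i : Expr)
  | inp (i : Expr)
  | op (o : Op) (e f : Expr)

/-- The time needed to evaluate an expression: the number of its nodes. -/
def Expr.cost : Expr → ℕ
  | .lit _ => 1
  | .var _ => 1
  | .arr _ i => i.cost + 1
  | .inp i => i.cost + 1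
  | .op _ e f => e.cost + f.cost + 1

/-- The store of the machine. -/
@[ext]
structure Store where
  var : ℕ → ℕ
  arr : ℕ → ℕ → ℕ
  pos : ℕ

/-- The value of an expression, with word size `w` and input string `inp`. -/
def Expr.eval (w : ℕ) (inp : ℕ → ℕ) (s : Store) : Expr → ℕ
  | .lit c => c % 2 ^ w
  | .var x => s.var x
  | .arr a i => s.arr a (i.eval w inp s)
  | .inp i => inp (i.eval w inp s)
  | .op o e f => o.eval w (e.eval w inp s) (f.eval w inp s)

/-- Programs. `flip x` puts a fresh random bit into register `x`; `loop e c` repeats `c` as long as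
`e` is nonzero. -/
inductive Cmd
  | skip
  | assign (x : ℕ) (e : Expr)
  | store (a : ℕ) (i e : Expr)
  | flip (x : ℕ)
  | seq (c d : Cmd)
  | ite (e : Expr) (c d : Cmd)
  | loop (e : Expr) (c : Cmd)

/-- `Exec w inp ω c s t s'`: on word size `w`, input string `inp` and random bits `ω`, the program
`c` started in the store `s` halts after time `t` in the store `s'`. -/
inductive Exec (w : ℕ) (inp : ℕ → ℕ) (ω : ℕ → Bool) : Cmd → Store → ℕ → Store → Prop
  | skip (s : Store) : Exec w inp ω .skip s 1 s
  | assign (x : ℕ) (e : Expr) (s : Store) :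
      Exec w inp ω (.assign x e) s (e.cost + 1)
        { s with var := Function.update s.var x (e.eval w inp s) }
  | store (a : ℕ) (i e : Expr) (s : Store) :
      Exec w inp ω (.store a i e) s (i.cost + e.cost + 1)
        { s with arr := Function.update s.arr a
                          (Function.update (s.arr a) (i.eval w inp s) (e.eval w inp s)) }
  | flip (x : ℕ) (s : Store) :
      Exec w inp ω (.flip x) s 1
        { s with var := Function.update s.var x ((ω s.pos).toNat % 2 ^ w), pos := s.pos + 1 }
  | seq {c d : Cmd} {s s' s'' : Store} {t t' : ℕ} :
      Exec w inp ω c s t s' → Exec w inp ω d s' t' s'' → Exec w inp ω (.seq c d) s (t + t') s''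
  | ite_true {e : Expr} {c d : Cmd} {s s' : Store} {t : ℕ} : e.eval w inp s ≠ 0 →
      Exec w inp ω c s t s' → Exec w inp ω (.ite e c d) s (e.cost + 1 + t) s'
  | ite_false {e : Expr} {c d : Cmd} {s s' : Store} {t : ℕ} : e.eval w inp s = 0 →
      Exec w inp ω d s t s' → Exec w inp ω (.ite e c d) s (e.cost + 1 + t) s'
  | loop_true {e : Expr} {c : Cmd} {s s' s'' : Store} {t t' : ℕ} : e.eval w inp s ≠ 0 →
      Exec w inp ω c s t s' → Exec w inp ω (.loop e c) s' t' s'' →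
      Exec w inp ω (.loop e c) s (e.cost + 1 + t + t') s''
  | loop_false {e : Expr} {c : Cmd} {s : Store} : e.eval w inp s = 0 →
      Exec w inp ω (.loop e c) s (e.cost + 1) s

/-- The machine is deterministic once the random bits are fixed: running time and final store are
uniquely determined. -/
theorem Exec.unique {w : ℕ} {inp : ℕ → ℕ} {ω : ℕ → Bool} {c : Cmd} {s : Store} {t₁ t₂ : ℕ}
    {s₁ s₂ : Store} (h₁ : Exec w inp ω c s t₁ s₁) (h₂ : Exec w inp ω c s t₂ s₂) :
    t₁ = t₂ ∧ s₁ = s₂ := by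
  induction h₁ generalizing t₂ s₂ with
  | skip => cases h₂; exact ⟨rfl, rfl⟩
  | assign => cases h₂; exact ⟨rfl, rfl⟩
  | store => cases h₂; exact ⟨rfl, rfl⟩
  | flip => cases h₂; exact ⟨rfl, rfl⟩
  | seq _ _ ih ih' =>
    cases h₂ with
    | seq h h' =>
      obtain ⟨rfl, rfl⟩ := ih h
      obtain ⟨rfl, rfl⟩ := ih' h'
      exact ⟨rfl, rfl⟩
  | ite_true he _ ih =>
    cases h₂ with
    | ite_true _ h => obtain ⟨rfl, rfl⟩ := ih h; exact ⟨rfl, rfl⟩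
    | ite_false he' _ => exact absurd he' he
  | ite_false he _ ih =>
    cases h₂ with
    | ite_true he' _ => exact absurd he he'
    | ite_false _ h => obtain ⟨rfl, rfl⟩ := ih h; exact ⟨rfl, rfl⟩
  | loop_true he _ _ ih ih' =>
    cases h₂ with
    | loop_true _ h h' =>
      obtain ⟨rfl, rfl⟩ := ih h
      obtain ⟨rfl, rfl⟩ := ih' h'
      exact ⟨rfl, rfl⟩
    | loop_false he' => exact absurd he' he
  | loop_false he =>
    cases h₂ with
    | loop_true he' _ _ => exact absurd he he'
    | loop_false _ => exact ⟨rfl, rfl⟩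

/-- The law of a sequence of independent fair coin flips. -/
noncomputable def coinMeasure : MeasureTheory.Measure (ℕ → Bool) :=
  MeasureTheory.Measure.infinitePi fun _ => (PMF.uniformOfFintype Bool).toMeasure

/-! ### Preprocessing one string, then answering a query -/

/-- The string `X` as seen by the machine: cell `i` holds the code word of the `i`-th character
(counted from `0`), and cells beyond the end of the string hold `0`. -/
def inputOf {α : Type*} {w n : ℕ} (code : α ↪ Fin (2 ^ w)) (X : Fin n → α) (i : ℕ) : ℕ :=
  if h : i < n then (code (X ⟨i, h⟩) : ℕ) else 0

/-- The initial registers: register `0` holds `n`, register `1` holds `k`, the others hold `0`. -/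
def initVar (n k : ℕ) (x : ℕ) : ℕ := if x = 0 then n else if x = 1 then k else 0

/-- `Session prep query n k code A B ω t₁ t₂ out`: with random bits `ω`, the program `prep`, which
is given `n`, `k` and the string `B` only and starts with empty (all-zero) arrays, halts after time
`t₁`; then the program `query`, which is given `n`, `k`, the string `A` and the arrays left behind
by `prep`, and which uses fresh random bits, halts after time `t₂` with `out` in register `0`. -/
def Session {α : Type*} {w : ℕ} (prep query : Cmd) (n k : ℕ) (code : α ↪ Fin (2 ^ w))
    (A B : Fin n → α) (ω : ℕ → Bool) (t₁ t₂ out : ℕ) : Prop :=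
  ∃ s₁ s₂ : Store,
    Exec w (inputOf code B) ω prep ⟨initVar n k, fun _ _ => 0, 0⟩ t₁ s₁ ∧
    Exec w (inputOf code A) ω query ⟨initVar n k, s₁.arr, s₁.pos⟩ t₂ s₂ ∧
    s₂.var 0 = out

end GapEdit

namespace GapEdit

/-! ### Verifying programs with running times -/

/-! If `k ^ 2 > n`, the distance is at most `2 * n < 3 * k ^ 2` and YES is always allowed. Otherwise
let `K` be the largest power of two with `K ≤ k`, and cut the positions into blocks of length `K`.
In each of `L = 16 * clog 2 (n + 2)` repetitions every block draws a uniform offset below `2 * K`: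
an offset below `K` samples that position, any other samples nothing. Prefix sums modulo `2 ^ w` of
the sampled characters are stored for `A`, and for `B` on each of the `2 * k + 1` diagonals,
diagonal `d` pairing position `s` of `A` with `s + d - k` of `B`. Two segments on a diagonal are
tested by comparing differences of prefix sums, in every repetition.

Equal segments always pass (`agreeAll_of_match`). With at least `K` mismatches, the discrepancy in
one repetition is a sum of independent block contributions, each zero with probability at least one
half. Had every block a sample, the contributions of two blocks could cancel for certain; the chance
of having none prevents this. A block with `c` mismatches shrinks the excess over one half of the
probability of any value by the factor `1 - c / K` (`card_sum_eq_le`), so the sum vanishes with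
probability at most `(1 + 1 / e) / 2 ≤ 3 / 4`. Raised to the power `L`, this survives a union bound
over all diagonals and segments (`samplesReliable_prob`).

The query runs the furthest-reaching dynamic program over diagonals: row `e + 1` arises from row `e`
by one edit and a slide along the diagonal, where the slide is a binary search with the tests. Since
equal segments pass, the table gets at least as far as an optimal alignment (`IsTable.complete`). If
the tests are reliable, a slide overlooks fewer than `K` mismatches, so each row costs at most `K`,
and reaching the end proves a distance of at most `(k + 1) * K + k ≤ 3 * k ^ 2` (`IsTable.sound`).
The hashes of `B` take about `k * (n / k)` cells, those of `A` about `n / k`, and the table about `k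
^ 2`, up to logarithms. -/

instance : Add Expr := ⟨.op .add⟩
instance : Sub Expr := ⟨.op .sub⟩
instance : Mul Expr := ⟨.op .mul⟩
instance : Div Expr := ⟨.op .div⟩
instance : Mod Expr := ⟨.op .mod⟩

/-- The comparison `e < f`. -/
def Expr.less (e f : Expr) : Expr := .op .lt e f

/-- The comparison `e = f`. -/
def Expr.same (e f : Expr) : Expr := .op .eq e f

infixr:60 " ;; " => Cmd.seq

section Eval

variable (w : ℕ) (inp : ℕ → ℕ) (s : Store) (e f : Expr)

@[simp] theorem eval_add : (e + f).eval w inp s = (e.eval w inp s + f.eval w inp s) % 2 ^ w := rfl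
@[simp] theorem eval_sub :
    (e - f).eval w inp s = (e.eval w inp s + (2 ^ w - f.eval w inp s)) % 2 ^ w := rfl
@[simp] theorem eval_mul : (e * f).eval w inp s = (e.eval w inp s * f.eval w inp s) % 2 ^ w := rfl
@[simp] theorem eval_div : (e / f).eval w inp s = e.eval w inp s / f.eval w inp s := rfl
@[simp] theorem eval_mod : (e % f).eval w inp s = e.eval w inp s % f.eval w inp s := rfl
-- The fact `64 < 2 ^ w` turns the outcome `1 % 2 ^ w` into `1`; it also keeps the literals of the
-- programs, none above 16, from wrapping around.
@[simp] theorem eval_less [hw : Fact (64 < 2 ^ w)] : (e.less f).eval w inp s =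
    if e.eval w inp s < f.eval w inp s then 1 else 0 := by
  rw [← Nat.mod_eq_of_lt (show 1 < 2 ^ w from (by norm_num : 1 < 64).trans hw.out)]; rfl
@[simp] theorem eval_same [hw : Fact (64 < 2 ^ w)] : (e.same f).eval w inp s =
    if e.eval w inp s = f.eval w inp s then 1 else 0 := by
  rw [← Nat.mod_eq_of_lt (show 1 < 2 ^ w from (by norm_num : 1 < 64).trans hw.out)]; rfl
@[simp] theorem eval_lit [hw : Fact (64 < 2 ^ w)] {c : ℕ} (hc : c < 64) :
    (Expr.lit c).eval w inp s = c := Nat.mod_eq_of_lt (hc.trans hw.out)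
@[simp] theorem eval_var (x : ℕ) : (Expr.var x).eval w inp s = s.var x := rfl
@[simp] theorem eval_arr (a : ℕ) : (Expr.arr a e).eval w inp s = s.arr a (e.eval w inp s) := rfl
@[simp] theorem eval_inp : (Expr.inp e).eval w inp s = inp (e.eval w inp s) := rfl

@[simp] theorem cost_add : (e + f).cost = e.cost + f.cost + 1 := rfl
@[simp] theorem cost_sub : (e - f).cost = e.cost + f.cost + 1 := rfl
@[simp] theorem cost_mul : (e * f).cost = e.cost + f.cost + 1 := rfl
@[simp] theorem cost_div : (e / f).cost = e.cost + f.cost + 1 := rfl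
@[simp] theorem cost_mod : (e % f).cost = e.cost + f.cost + 1 := rfl
@[simp] theorem cost_less : (e.less f).cost = e.cost + f.cost + 1 := rfl
@[simp] theorem cost_same : (e.same f).cost = e.cost + f.cost + 1 := rfl
@[simp] theorem cost_lit (c : ℕ) : (Expr.lit c).cost = 1 := rfl
@[simp] theorem cost_var (x : ℕ) : (Expr.var x).cost = 1 := rfl
@[simp] theorem cost_arr (a : ℕ) : (Expr.arr a e).cost = e.cost + 1 := rfl
@[simp] theorem cost_inp : (Expr.inp e).cost = e.cost + 1 := rfl

end Eval

/-- Started in the store `s`, the program `c` halts within time `T` in a store satisfying `Q`. -/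
def Runs (w : ℕ) (inp : ℕ → ℕ) (ω : ℕ → Bool) (c : Cmd) (s : Store) (T : ℕ) (Q : Store → Prop) :
    Prop :=
  ∃ t s', Exec w inp ω c s t s' ∧ t ≤ T ∧ Q s'

namespace Runs

variable {w : ℕ} {inp : ℕ → ℕ} {ω : ℕ → Bool} {c d : Cmd} {s : Store} {T T' : ℕ}
  {Q Q' : Store → Prop} {e i : Expr} {x a : ℕ}

theorem mono (h : Runs w inp ω c s T Q) (hT : T ≤ T') (hQ : ∀ s', Q s' → Q' s') :
    Runs w inp ω c s T' Q' := by
  obtain ⟨t, s', h, ht, hq⟩ := h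
  exact ⟨t, s', h, ht.trans hT, hQ _ hq⟩

theorem skip (hT : 1 ≤ T) (h : Q s) : Runs w inp ω .skip s T Q := ⟨_, _, .skip s, hT, h⟩

theorem assign (hT : e.cost + 1 ≤ T)
    (h : Q { s with var := Function.update s.var x (e.eval w inp s) }) :
    Runs w inp ω (.assign x e) s T Q := ⟨_, _, .assign x e s, hT, h⟩

theorem store (hT : i.cost + e.cost + 1 ≤ T)
    (h : Q { s with arr := Function.update s.arr a
                          (Function.update (s.arr a) (i.eval w inp s) (e.eval w inp s)) }) :
    Runs w inp ω (.store a i e) s T Q := ⟨_, _, .store a i e s, hT, h⟩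

theorem flip (hT : 1 ≤ T)
    (h : Q { s with var := Function.update s.var x ((ω s.pos).toNat % 2 ^ w), pos := s.pos + 1 }) :
    Runs w inp ω (.flip x) s T Q := ⟨_, _, .flip x s, hT, h⟩

/-- The postcondition of the first command is a run of the second one on the remaining budget, so
programs are verified by symbolic execution from left to right. -/
theorem seq (T₁ : ℕ) (hT : T₁ ≤ T)
    (h : Runs w inp ω c s T₁ fun s' => Runs w inp ω d s' (T - T₁) Q) :
    Runs w inp ω (c ;; d) s T Q := by
  obtain ⟨t, s', h, ht, t', s'', h', ht', hq⟩ := h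
  exact ⟨_, _, .seq h h', by omega, hq⟩

theorem assign_seq (hT : e.cost + 1 ≤ T)
    (h : Runs w inp ω d { s with var := Function.update s.var x (e.eval w inp s) }
      (T - (e.cost + 1)) Q) :
    Runs w inp ω (.assign x e ;; d) s T Q :=
  seq _ hT (assign le_rfl h)

theorem store_seq (hT : i.cost + e.cost + 1 ≤ T)
    (h : Runs w inp ω d
      { s with arr := Function.update s.arr a
                        (Function.update (s.arr a) (i.eval w inp s) (e.eval w inp s)) }
      (T - (i.cost + e.cost + 1)) Q) :
    Runs w inp ω (.store a i e ;; d) s T Q :=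
  seq _ hT (store le_rfl h)

theorem flip_seq (hT : 1 ≤ T)
    (h : Runs w inp ω d
      { s with var := Function.update s.var x ((ω s.pos).toNat % 2 ^ w), pos := s.pos + 1 }
      (T - 1) Q) :
    Runs w inp ω (.flip x ;; d) s T Q :=
  seq _ hT (flip le_rfl h)

theorem ite (hT : e.cost + 1 ≤ T)
    (h₁ : e.eval w inp s ≠ 0 → Runs w inp ω c s (T - (e.cost + 1)) Q)
    (h₂ : e.eval w inp s = 0 → Runs w inp ω d s (T - (e.cost + 1)) Q) :
    Runs w inp ω (.ite e c d) s T Q := by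
  by_cases he : e.eval w inp s = 0
  · obtain ⟨t, s', h, ht, hq⟩ := h₂ he
    exact ⟨_, _, .ite_false he h, by omega, hq⟩
  · obtain ⟨t, s', h, ht, hq⟩ := h₁ he
    exact ⟨_, _, .ite_true he h, by omega, hq⟩

/-- A loop with exactly `N` rounds. -/
theorem loop (I : ℕ → Store → Prop) (N T₀ : ℕ) (h0 : I 0 s) (hT : N * (e.cost + 1 + T₀) + (e.cost + 1) ≤ T)
    (hstep : ∀ i s, i < N → I i s → e.eval w inp s ≠ 0 ∧ Runs w inp ω c s T₀ (I (i + 1)))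
    (hend : ∀ s, I N s → e.eval w inp s = 0) :
    Runs w inp ω (.loop e c) s T (I N) := by
  suffices H : ∀ m i s, i + m = N → I i s →
      Runs w inp ω (.loop e c) s (m * (e.cost + 1 + T₀) + (e.cost + 1)) (I N) from
    (H N 0 s (by omega) h0).mono hT fun _ h => h
  intro m
  induction m with
  | zero =>
    rintro i s rfl hi
    exact ⟨_, _, .loop_false (hend s hi), by omega, hi⟩
  | succ m ih =>
    intro i s him hi
    obtain ⟨he, t, s', h, ht, hi'⟩ := hstep i s (by omega) hi
    obtain ⟨t', s'', h', ht', hq⟩ := ih (i + 1) s' (by omega) hi'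
    exact ⟨_, _, .loop_true he h h', by rw [Nat.succ_mul]; omega, hq⟩

end Runs

/-! ### The programs -/

open GapEdit.Expr (lit var arr inp)

/-- Compute the block length (register 2), a power of two exceeding `n` (register 3), the number
of repetitions (register 4), the number of blocks (register 5) and the number of diagonals
(register 6). -/
def setup : Cmd :=
  .assign 2 (lit 1) ;;
  .loop ((var 2 + var 2).less (var 1 + lit 1)) (.assign 2 (var 2 + var 2)) ;;
  .assign 3 (lit 1) ;; .assign 4 (lit 0) ;;
  .loop ((var 3).less (var 0 + lit 2)) (.assign 3 (var 3 + var 3) ;; .assign 4 (var 4 + lit 16)) ;;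
  .assign 5 (var 0 / var 2 + lit 1) ;; .assign 6 (var 1 + var 1 + lit 1)

/-- Draw a number below twice the block length into register 8. -/
def drawNumber : Cmd :=
  .assign 8 (lit 0) ;; .assign 9 (lit 1) ;;
  .loop ((var 9).less (var 2 + var 2))
    (.flip 10 ;; .assign 8 (var 8 + var 9 * var 10) ;; .assign 9 (var 9 + var 9))

/-- Fill array 0 with random numbers, one for each repetition and each block. -/
def drawSamples : Cmd :=
  .assign 7 (lit 0) ;;
  .loop ((var 7).less (var 4 * var 5))
    (drawNumber ;; .store 0 (var 7) (var 8) ;; .assign 7 (var 7 + lit 1))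

/-- Prefix sums of the sampled characters of `B`, for every repetition and every diagonal. -/
def hashB : Cmd :=
  .assign 7 (lit 0) ;;
  .loop ((var 7).less (var 4 * var 6 * var 5))
    (.assign 8 (var 7 % var 5) ;;
     .assign 9 (var 7 / var 5) ;;
     .assign 10 (arr 0 (var 9 / var 6 * var 5 + var 8)) ;;
     .store 1 (var 7 + lit 1) (arr 1 (var 7) + (var 10).less (var 2) *
        inp (var 8 * var 2 + var 10 + var 9 % var 6 - var 1)) ;;
     .assign 7 (var 7 + lit 1))

/-- Prefix sums of the sampled characters of `A`, for every repetition. -/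
def hashA : Cmd :=
  .assign 7 (lit 0) ;;
  .loop ((var 7).less (var 4 * var 5))
    (.assign 8 (arr 0 (var 7)) ;;
     .store 2 (var 7 + lit 1) (arr 2 (var 7) + (var 8).less (var 2) *
        inp (var 7 % var 5 * var 2 + var 8)) ;;
     .assign 7 (var 7 + lit 1))

/-- Put into register 12 whether the sampled characters at the positions from register 9 up to
register 11 agree, on the diagonal one less than register 8. -/
def compareHashes : Cmd :=
  .assign 12 (lit 1) ;; .assign 13 (lit 0) ;;
  .loop ((var 13).less (var 4))
    (.assign 14 (var 13 * var 5) ;;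
     .assign 15 (var 9 / var 2 + (arr 0 (var 14 + var 9 / var 2)).less (var 9 % var 2)) ;;
     .assign 16 (var 11 / var 2 + (arr 0 (var 14 + var 11 / var 2)).less (var 11 % var 2)) ;;
     .assign 17 ((var 13 * var 6 + (var 8 - lit 1)) * var 5) ;;
     .assign 12 (var 12 * (arr 2 (var 14 + var 16) + arr 1 (var 17 + var 15)).same
        (arr 2 (var 14 + var 15) + arr 1 (var 17 + var 16))) ;;
     .assign 13 (var 13 + lit 1))

/-- Advance register 9 along a diagonal as long as the sampled characters agree. -/
def slide : Cmd :=
  .assign 10 (var 3) ;;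
  .loop (var 10)
    (.assign 11 (var 9 + var 10) ;;
     .ite ((var 11).less (var 0 + lit 1))
       (compareHashes ;; .ite (var 12) (.assign 9 (var 11)) .skip) .skip ;;
     .assign 10 (var 10 / lit 2))

/-- Raise register `x` to the value of `e`. -/
def raise (x : ℕ) (e : Expr) : Cmd := .ite ((var x).less e) (.assign x e) .skip

/-- Fill the table of furthest reaching positions in array 3. -/
def fillTable : Cmd :=
  .assign 7 (lit 0) ;;
  .loop ((var 7).less ((var 1 + lit 1) * (var 6 + lit 1)))
    (.assign 8 (var 7 % (var 6 + lit 1)) ;;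
     .ite (var 8)
       (.assign 9 (arr 3 (var 7) + lit 1) ;;
        raise 9 (arr 3 (var 7 + lit 1) + lit 1) ;;
        raise 9 (arr 3 (var 7 - lit 1)) ;;
        .ite ((var 0).less (var 9)) (.assign 9 (var 0)) .skip ;;
        slide ;;
        .store 3 (var 7 + (var 6 + lit 1)) (var 9)) .skip ;;
     .assign 7 (var 7 + lit 1))

/-- The preprocessing program. -/
def prepProgram : Cmd :=
  .ite ((var 0 / var 1).less (var 1)) .skip (setup ;; drawSamples ;; hashB)

/-- The query program. -/
def queryProgram : Cmd :=
  .ite ((var 0 / var 1).less (var 1)) (.assign 0 (lit 1))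
    (setup ;; hashA ;; fillTable ;;
     .assign 0 ((arr 3 ((var 1 + lit 1) * (var 6 + lit 1) + (var 1 + lit 1))).same (var 0)))

end GapEdit

namespace GapEdit
open GapEdit.Expr (lit var arr inp)

/-! ### What the programs compute -/

/-- The parameters held by the registers `0` to `6`. -/
structure Regs (n k K N L nb D : ℕ) (s : Store) : Prop where
  r0 : s.var 0 = n
  r1 : s.var 1 = k
  r2 : s.var 2 = K
  r3 : s.var 3 = N
  r4 : s.var 4 = L
  r5 : s.var 5 = nb
  r6 : s.var 6 = D

theorem Regs.congr {n k K N L nb D : ℕ} {s s' : Store} (h : Regs n k K N L nb D s)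
    (hs : ∀ x < 7, s'.var x = s.var x) : Regs n k K N L nb D s' :=
  ⟨(hs 0 (by simp)).trans h.r0, (hs 1 (by simp)).trans h.r1, (hs 2 (by simp)).trans h.r2,
    (hs 3 (by simp)).trans h.r3, (hs 4 (by simp)).trans h.r4, (hs 5 (by simp)).trans h.r5,
    (hs 6 (by simp)).trans h.r6⟩

variable {w : ℕ} {inp : ℕ → ℕ} {ω : ℕ → Bool} [Fact (64 < 2 ^ w)]

theorem setup_runs {n k : ℕ} (hk : 1 ≤ k) (hkn : k ≤ n) (hw : 64 * (n + 2) < 2 ^ w) {s : Store}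
    (h0 : s.var 0 = n) (h1 : s.var 1 = k) :
    Runs w inp ω setup s (100 * (Nat.clog 2 (n + 2) + 1))
      (fun s' => Regs n k (2 ^ Nat.log 2 k) (2 ^ Nat.clog 2 (n + 2)) (16 * Nat.clog 2 (n + 2))
        (n / 2 ^ Nat.log 2 k + 1) (k + k + 1) s' ∧ s'.arr = s.arr ∧ s'.pos = s.pos) := by
  set l := Nat.clog 2 (n + 2) with hl
  set a := Nat.log 2 k with ha
  have hal : a ≤ l := (Nat.log_mono_right (by omega)).trans (Nat.log_le_clog 2 (n + 2))
  have ha1 : 2 ^ a ≤ k := Nat.pow_log_le_self 2 (by omega)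
  have ha2 : k < 2 ^ (a + 1) := Nat.lt_pow_succ_log_self (by omega) k
  have hl1 : n + 2 ≤ 2 ^ l := Nat.le_pow_clog (by omega) _
  have hl2 : ∀ i < l, 2 ^ i < n + 2 := fun i hi => Nat.pow_lt_of_lt_clog hi
  -- Keeps the number of repetitions, `16 * l`, within a word.
  have hll : l < n + 2 := by
    have : l - 1 < 2 ^ (l - 1) := Nat.lt_two_pow_self
    by_cases h : l = 0
    · omega
    · have := hl2 (l - 1) (by omega); omega
  refine .assign_seq (by simp; omega) ?_
  refine .seq (13 * l + 9) (by simp; omega) ((Runs.loop (fun i s' => s'.var 2 = 2 ^ i ∧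
    s'.var 0 = n ∧ s'.var 1 = k ∧ s'.arr = s.arr ∧ s'.pos = s.pos) a 5 ?_ ?_ ?_ ?_).mono le_rfl ?_)
  · simp [h0, h1]
  · simp
    omega
  · rintro i s' hi ⟨h2, h0, h1, hA, hp⟩
    have : 2 ^ (i + 1) ≤ 2 ^ a := Nat.pow_le_pow_right (by omega) hi
    rw [pow_succ] at this
    constructor
    · simp [h2, h1]
      rw [Nat.mod_eq_of_lt, Nat.mod_eq_of_lt] <;> omega
    · refine .assign (by simp) ?_
      simp [h0, h1, h2, hA, hp]
      rw [Nat.mod_eq_of_lt] <;> omega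
  · rintro s' ⟨h2, h0, h1, hA, hp⟩
    simp [h2, h1]
    rw [pow_succ] at ha2
    rw [Nat.mod_eq_of_lt, Nat.mod_eq_of_lt] <;> omega
  rintro s₁ ⟨h2, h0, h1, hA, hp⟩
  refine .assign_seq (by simp; omega) (.assign_seq (by simp; omega) ?_)
  refine .seq (14 * l + 6) (by simp; omega) ((Runs.loop (fun i s' => s'.var 3 = 2 ^ i ∧
    s'.var 4 = 16 * i ∧ s'.var 2 = 2 ^ a ∧
    s'.var 0 = n ∧ s'.var 1 = k ∧ s'.arr = s.arr ∧ s'.pos = s.pos) l 8 ?_ ?_ ?_ ?_).mono le_rfl ?_)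
  · simp [h0, h1, h2, hA, hp]
  · simp
    omega
  · rintro i s' hi ⟨h3, h4, h2, h0, h1, hA, hp⟩
    have := hl2 i hi
    constructor
    · simp [h3, h0]
      rw [Nat.mod_eq_of_lt] <;> omega
    · refine .assign_seq (by simp) (.assign (by simp) ?_)
      simp [h0, h1, h2, h3, h4, hA, hp]
      rw [Nat.mod_eq_of_lt, Nat.mod_eq_of_lt] <;> omega
  · rintro s' ⟨h3, h4, h2, h0, h1, hA, hp⟩
    simp [h3, h0]
    rw [Nat.mod_eq_of_lt] <;> omega
  rintro s₂ ⟨h3, h4, h2, h0, h1, hA, hp⟩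
  have hdiv : n / 2 ^ a ≤ n := Nat.div_le_self _ _
  refine .assign_seq (by simp; omega) (.assign (by simp; omega) ⟨⟨?_, ?_, ?_, ?_, ?_, ?_, ?_⟩, ?_, ?_⟩) <;>
    simp [h0, h1, h2, h3, h4, hA, hp]
  · apply Nat.mod_eq_of_lt; omega
  · apply Nat.mod_eq_of_lt; omega

/-- The number with the `m` binary digits `f 0, …, f (m - 1)`, the least significant one first. -/
def ofDigits (f : ℕ → Bool) (m : ℕ) : ℕ := ∑ t ∈ Finset.range m, 2 ^ t * (f t).toNat

theorem ofDigits_lt (f : ℕ → Bool) (m : ℕ) : ofDigits f m < 2 ^ m := by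
  induction m with
  | zero => simp [ofDigits]
  | succ m ih =>
    have := (f m).toNat_le
    rw [ofDigits, Finset.sum_range_succ, ← ofDigits, pow_succ]
    nlinarith [Nat.two_pow_pos m]

theorem drawNumber_runs {n k a N L nb D : ℕ} {s : Store} (hw : 2 ^ (a + 2) ≤ 2 ^ w)
    (hs : Regs n k (2 ^ a) N L nb D s) :
    Runs w inp ω drawNumber s (20 * (a + 2))
      (fun s' => Regs n k (2 ^ a) N L nb D s' ∧ s'.var 7 = s.var 7 ∧ s'.arr = s.arr ∧
        s'.pos = s.pos + (a + 1) ∧ s'.var 8 = ofDigits (fun t => ω (s.pos + t)) (a + 1)) := by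
  have hw1 : 2 ^ (a + 1) * 2 ≤ 2 ^ w := by rw [← pow_succ]; exact hw
  have hpa : 0 < 2 ^ a := by positivity
  have hpa1 : 2 ^ (a + 1) = 2 ^ a * 2 := pow_succ _ _
  refine .assign_seq (by simp; omega) (.assign_seq (by simp; omega) ?_)
  refine (Runs.loop (fun i s' => Regs n k (2 ^ a) N L nb D s' ∧ s'.var 7 = s.var 7 ∧ s'.arr = s.arr ∧
        s'.pos = s.pos + i ∧ s'.var 8 = ofDigits (fun t => ω (s.pos + t)) i ∧ s'.var 9 = 2 ^ i)
        (a + 1) 11 ?_ ?_ ?_ ?_).mono le_rfl ?_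
  · refine ⟨hs.congr fun x hx => ?_, ?_, ?_, ?_, ?_, ?_⟩
    · simp [show x ≠ 9 by omega, show x ≠ 8 by omega]
    · simp
    · simp
    · simp
    · simp [ofDigits]
    · simp
  · simp
    omega
  · rintro i s' hi ⟨hs', h7, hA, hp, h8, h9⟩
    have hpi : 2 ^ (i + 1) ≤ 2 ^ (a + 1) := Nat.pow_le_pow_right (by omega) hi
    have hpi1 : 2 ^ (i + 1) = 2 ^ i * 2 := pow_succ _ _
    constructor
    · simp [h9, hs'.r2]
      rw [Nat.mod_eq_of_lt] <;> omega
    · refine .flip_seq (by simp) (.assign_seq (by simp) (.assign (by simp)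
        ⟨hs'.congr fun x hx => ?_, ?_, ?_, ?_, ?_, ?_⟩))
      · simp [show x ≠ 9 by omega, show x ≠ 8 by omega, show x ≠ 10 by omega]
      · simp [h7]
      · simp [hA]
      · simp [hp]; omega
      · have hlt := ofDigits_lt (fun t => ω (s.pos + t)) (i + 1)
        rw [ofDigits, Finset.sum_range_succ, ← ofDigits] at hlt ⊢
        simp [h8, h9, hp]
        exact Nat.mod_eq_of_lt (by omega)
      · simp [h9]
        rw [Nat.mod_eq_of_lt] <;> omega
  · rintro s' ⟨hs', h7, hA, hp, h8, h9⟩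
    simp [h9, hs'.r2]
    rw [Nat.mod_eq_of_lt] <;> omega
  · rintro s' ⟨hs', h7, hA, hp, h8, h9⟩
    exact ⟨hs', h7, hA, hp, h8⟩

/-- The `q`-th random number, read off from `m` consecutive random bits. -/
def sample (ω : ℕ → Bool) (m q : ℕ) : ℕ := ofDigits (fun t => ω (q * m + t)) m

theorem drawSamples_runs {n k a N L nb D : ℕ} {s : Store} (hw : 2 ^ (a + 2) ≤ 2 ^ w)
    (hw' : L * nb < 2 ^ w) (hs : Regs n k (2 ^ a) N L nb D s) (hpos : s.pos = 0) :
    Runs w inp ω drawSamples s ((L * nb) * (20 * (a + 2) + 13) + 8)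
      (fun s' => Regs n k (2 ^ a) N L nb D s' ∧ (∀ b, b ≠ 0 → s'.arr b = s.arr b) ∧
        ∀ q < L * nb, s'.arr 0 q = sample ω (a + 1) q) := by
  refine .assign_seq (by simp) ?_
  refine (Runs.loop (fun i s' => Regs n k (2 ^ a) N L nb D s' ∧ s'.var 7 = i ∧
      s'.pos = i * (a + 1) ∧ (∀ b, b ≠ 0 → s'.arr b = s.arr b) ∧
        ∀ q < i, s'.arr 0 q = sample ω (a + 1) q) (L * nb) (20 * (a + 2) + 7) ?_ ?_ ?_ ?_).mono
      le_rfl ?_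
  · refine ⟨hs.congr fun x hx => ?_, ?_, ?_, ?_, ?_⟩
    · simp [show x ≠ 7 by omega]
    · simp
    · simp [hpos]
    · simp
    · simp
  · simp
    ring_nf
    omega
  · rintro i s' hi ⟨hs', h7, hp, hA, hA0⟩
    constructor
    · simp [h7, hs'.r4, hs'.r5]
      rw [Nat.mod_eq_of_lt (by omega)]
      omega
    · refine .seq (20 * (a + 2)) (by omega) ((drawNumber_runs hw hs').mono le_rfl ?_)
      rintro s₁ ⟨hs₁, h7₁, hA₁, hp₁, h8⟩
      refine .store_seq (by simp) (.assign (by simp)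
        ⟨hs₁.congr fun x hx => ?_, ?_, ?_, ?_, ?_⟩)
      · simp [show x ≠ 7 by omega]
      · simp [h7₁, h7]; apply Nat.mod_eq_of_lt; omega
      · simp [hp₁, hp]; ring
      · intro b hb; simp [hb, hA₁, hA b hb]
      · intro q hq
        simp only [Function.update_self]
        by_cases hqi : q = i
        · subst hqi
          simp [h7₁, h7, h8, hp, sample]
        · simp [h7₁, h7, hqi, hA₁]
          exact hA0 q (by omega)
  · rintro s' ⟨hs', h7, -⟩
    simp [h7, hs'.r4, hs'.r5]
    rw [Nat.mod_eq_of_lt hw']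
  · rintro s' ⟨hs', h7, hp, hA, hA0⟩
    exact ⟨hs', hA, hA0⟩

end GapEdit

/-! ### Prefix sums of the sampled characters -/

namespace GapEdit
open GapEdit.Expr (lit var arr inp)

variable {w : ℕ} {inp : ℕ → ℕ} {ω : ℕ → Bool} [Fact (64 < 2 ^ w)]

/-- The string `inp`, shifted by `k` cells. -/
def shifted (w k : ℕ) (inp : ℕ → ℕ) (t : ℕ) : ℕ := inp ((t + (2 ^ w - k)) % 2 ^ w)

/-- The contribution of one sample to the prefix sums of `A`. -/
def termA (inp : ℕ → ℕ) (K nb : ℕ) (u : ℕ → ℕ) (q : ℕ) : ℕ :=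
  if u q < K then inp (q % nb * K + u q) else 0

/-- The contribution of one sample to the prefix sums of `B`, which is given with padding. -/
def termB (inp : ℕ → ℕ) (K D nb : ℕ) (u : ℕ → ℕ) (q : ℕ) : ℕ :=
  if u (q / nb / D * nb + q % nb) < K then
    inp (q % nb * K + u (q / nb / D * nb + q % nb) + q / nb % D) else 0

theorem index_lt {x y m n : ℕ} (hx : x < m) (hy : y < n) : x * n + y < m * n := by
  nlinarith

/-- The index `p` encodes the repetition `p / nb / D`, the diagonal `p / nb % D` and the block `p %
nb`. A single running sum through all rows suffices, because the tests only use differences within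
one row. -/
theorem hashB_runs {n k K N L nb D : ℕ} {s : Store} {u : ℕ → ℕ} (hs : Regs n k K N L nb D s)
    (hu : ∀ q < L * nb, s.arr 0 q = u q) (h0 : s.arr 1 0 = 0)
    (hw1 : L * D * nb < 2 ^ w) (hw2 : L * nb < 2 ^ w)
    (hD : 0 < D) :
    Runs w inp ω hashB s (L * D * nb * 60 + 20) (fun s' => (∀ b, b ≠ 1 → s'.arr b = s.arr b) ∧
      ∀ q ≤ L * D * nb, s'.arr 1 q =
        (∑ p ∈ Finset.range q, termB (shifted w k inp) K D nb u p) % 2 ^ w) := by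
  refine .assign_seq (by simp) ?_
  refine (Runs.loop (fun i s' => Regs n k K N L nb D s' ∧ s'.var 7 = i ∧
      (∀ b, b ≠ 1 → s'.arr b = s.arr b) ∧ ∀ q ≤ i, s'.arr 1 q =
        (∑ p ∈ Finset.range q, termB (shifted w k inp) K D nb u p) % 2 ^ w)
      (L * D * nb) 50 ?_ ?_ ?_ ?_).mono le_rfl ?_
  · refine ⟨hs.congr fun x hx => ?_, ?_, ?_, ?_⟩
    · simp [show x ≠ 7 by omega]
    · simp
    · simp
    · simp [h0]
  · simp
    omega
  · rintro i s' hi ⟨hs', h7, hA, hA1⟩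
    have hnb : 0 < nb := Nat.pos_of_ne_zero fun h => by simp [h] at hi
    constructor
    · simp [h7, hs'.r4, hs'.r5, hs'.r6]
      rw [Nat.mod_eq_of_lt (by omega)]
      omega
    · have hb : i % nb < nb := Nat.mod_lt _ hnb
      have hj : i / nb / D < L := by
        rw [Nat.div_div_eq_div_mul]
        exact Nat.div_lt_of_lt_mul (by nlinarith)
      have hd : i / nb % D < D := Nat.mod_lt _ hD
      have hjb := index_lt hj hb
      refine .assign_seq (by simp) (.assign_seq (by simp) (.assign_seq (by simp)
        (.store_seq (by simp) (.assign (by simp) ⟨hs'.congr fun x hx => ?_, ?_, ?_, ?_⟩))))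
      · simp [show x ≠ 7 by omega, show x ≠ 8 by omega, show x ≠ 9 by omega, show x ≠ 10 by omega]
      · simp [h7]; apply Nat.mod_eq_of_lt; omega
      · intro b hb; simp [hb, hA b hb]
      · intro q hq
        simp [h7, hs'.r1, hs'.r2, hs'.r5, hs'.r6]
        have e1 : (i + 1) % 2 ^ w = i + 1 := Nat.mod_eq_of_lt (by omega)
        rw [e1]
        by_cases hqi : q = i + 1
        · subst hqi
          rw [Function.update_self, Nat.mod_eq_of_lt (hjb.trans hw2), hA 0 (by simp), hu _ hjb,
            hA1 i (by omega), Finset.sum_range_succ, Nat.mod_add_mod]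
          simp [termB, shifted]
        · rw [Function.update_of_ne hqi]
          exact hA1 q (by omega)
  · rintro s' ⟨hs', h7, hA, hA1⟩
    simp [h7, hs'.r4, hs'.r5, hs'.r6]
    rw [Nat.mod_eq_of_lt hw1]
  · rintro s' ⟨hs', h7, hA, hA1⟩
    exact ⟨hA, hA1⟩

theorem hashA_runs {n k K N L nb D : ℕ} {s : Store} {u : ℕ → ℕ} (hs : Regs n k K N L nb D s)
    (hu : ∀ q < L * nb, s.arr 0 q = u q) (hu' : ∀ q, u q < 2 * K) (h0 : s.arr 2 0 = 0)
    (hw : nb * K + 2 * K < 2 ^ w) (hw2 : L * nb < 2 ^ w) :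
    Runs w inp ω hashA s (L * nb * 40 + 20) (fun s' => Regs n k K N L nb D s' ∧
      (∀ b, b ≠ 2 → s'.arr b = s.arr b) ∧
      ∀ q ≤ L * nb, s'.arr 2 q = (∑ p ∈ Finset.range q, termA inp K nb u p) % 2 ^ w) := by
  refine .assign_seq (by simp) ?_
  refine (Runs.loop (fun i s' => Regs n k K N L nb D s' ∧ s'.var 7 = i ∧
      (∀ b, b ≠ 2 → s'.arr b = s.arr b) ∧ ∀ q ≤ i, s'.arr 2 q =
        (∑ p ∈ Finset.range q, termA inp K nb u p) % 2 ^ w)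
      (L * nb) 34 ?_ ?_ ?_ ?_).mono le_rfl ?_
  · refine ⟨hs.congr fun x hx => ?_, ?_, ?_, ?_⟩
    · simp [show x ≠ 7 by omega]
    · simp
    · simp
    · simp [h0]
  · simp
  · rintro i s' hi ⟨hs', h7, hA, hA1⟩
    have hnb : 0 < nb := Nat.pos_of_ne_zero fun h => by simp [h] at hi
    constructor
    · simp [h7, hs'.r4, hs'.r5]
      rw [Nat.mod_eq_of_lt (by omega)]
      omega
    · have hb : i % nb < nb := Nat.mod_lt _ hnb
      have hbK : i % nb * K ≤ nb * K := Nat.mul_le_mul_right _ hb.le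
      have huq := hu' i
      refine .assign_seq (by simp) (.store_seq (by simp) (.assign (by simp)
        ⟨hs'.congr fun x hx => ?_, ?_, ?_, ?_⟩))
      · simp [show x ≠ 7 by omega, show x ≠ 8 by omega]
      · simp [h7]; apply Nat.mod_eq_of_lt; omega
      · intro b hb; simp [hb, hA b hb]
      · intro q hq
        simp [h7, hs'.r2, hs'.r5]
        have e1 : (i + 1) % 2 ^ w = i + 1 := Nat.mod_eq_of_lt (by omega)
        rw [e1]
        by_cases hqi : q = i + 1
        · subst hqi
          rw [Function.update_self, hA 0 (by simp), hu _ hi, hA1 i (by omega),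
            Finset.sum_range_succ, Nat.mod_add_mod, Nat.mod_eq_of_lt (a := i % nb * K + _)
            (by omega)]
          simp [termA]
        · rw [Function.update_of_ne hqi]
          exact hA1 q (by omega)
  · rintro s' ⟨hs', h7, hA, hA1⟩
    simp [h7, hs'.r4, hs'.r5]
    rw [Nat.mod_eq_of_lt hw2]
  · rintro s' ⟨hs', h7, hA, hA1⟩
    exact ⟨hs', hA, hA1⟩

end GapEdit

/-! ### Segment tests, sliding along a diagonal, and filling the table -/

namespace GapEdit
open GapEdit.Expr (lit var arr inp)

variable {w : ℕ} {inp : ℕ → ℕ} {ω : ℕ → Bool}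

/-- The number of blocks whose sample, if any, lies before position `i`, up to blocks without a
sample. -/
def cut (K : ℕ) (u : ℕ → ℕ) (i : ℕ) : ℕ := i / K + if u (i / K) < i % K then 1 else 0

/-- In the `j`-th repetition, the samples of the two strings between the positions `x` and `z` agree
on the diagonal `d`. -/
def Agree (w K nb D : ℕ) (u hA hB : ℕ → ℕ) (j d x z : ℕ) : Prop :=
  hA (j * nb + cut K (fun b => u (j * nb + b)) z) +
      hB ((j * D + d) * nb + cut K (fun b => u (j * nb + b)) x) ≡
    hA (j * nb + cut K (fun b => u (j * nb + b)) x) +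
      hB ((j * D + d) * nb + cut K (fun b => u (j * nb + b)) z) [MOD 2 ^ w]

/-- All `L` repetitions agree. -/
def AgreeAll (w K L nb D : ℕ) (u hA hB : ℕ → ℕ) (d x z : ℕ) : Prop :=
  ∀ j < L, Agree w K nb D u hA hB j d x z

theorem AgreeAll.refl {K L nb D : ℕ} {u hA hB : ℕ → ℕ} {d x : ℕ} :
    AgreeAll w K L nb D u hA hB d x x := fun _ _ => rfl

/-- Agreement is an equality between differences of prefix sums, and these telescope. Hence `slide`
may compose its jumps and still vouch for the whole segment. -/
theorem AgreeAll.trans {K L nb D : ℕ} {u hA hB : ℕ → ℕ} {d x y z : ℕ}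
    (h : AgreeAll w K L nb D u hA hB d x y) (h' : AgreeAll w K L nb D u hA hB d y z) :
    AgreeAll w K L nb D u hA hB d x z := by
  intro j hj
  have h₁ := (h j hj).add (h' j hj)
  refine Nat.ModEq.add_right_cancel' (hA (j * nb + cut K (fun b => u (j * nb + b)) y) +
    hB ((j * D + d) * nb + cut K (fun b => u (j * nb + b)) y)) ?_
  convert h₁ using 1 <;> ring

variable [Fact (64 < 2 ^ w)]

-- Register 12 is the product of the outcomes, so it remains `1` exactly while all repetitions
-- agree. The test adds instead of subtracting: a sum of prefix sums on either side, modulo `2 ^ w`.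
open Classical in
theorem compareHashes_runs {n k K N L nb D d x z : ℕ} {s : Store} (hs : Regs n k K N L nb D s)
    (h8 : s.var 8 = d + 1) (h9 : s.var 9 = x) (h11 : s.var 11 = z) (hd : d < D)
    (hx : x ≤ n) (hz : z ≤ n) (hn : n / K < nb) (hw1 : L * D * nb + nb < 2 ^ w)
    (hw2 : L * nb + nb < 2 ^ w) (hw3 : D < 2 ^ w) :
    Runs w inp ω compareHashes s (L * 110 + 20) (fun s' => (∀ y < 12, s'.var y = s.var y) ∧
      s'.arr = s.arr ∧ s'.pos = s.pos ∧
      s'.var 12 = if AgreeAll w K L nb D (s.arr 0) (s.arr 2) (s.arr 1) d x z then 1 else 0) := by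
  refine .assign_seq (by simp) (.assign_seq (by simp) ?_)
  refine (Runs.loop (fun i s' => (∀ y < 12, s'.var y = s.var y) ∧
      s'.arr = s.arr ∧ s'.pos = s.pos ∧ s'.var 13 = i ∧
      s'.var 12 = if AgreeAll w K i nb D (s.arr 0) (s.arr 2) (s.arr 1) d x z then 1 else 0)
      L 105 ?_ ?_ ?_ ?_).mono le_rfl ?_
  · refine ⟨fun x hx => ?_, ?_, ?_, ?_, ?_⟩
    · simp [show x ≠ 12 by omega, show x ≠ 13 by omega]
    · simp
    · simp
    · simp
    · simp [AgreeAll]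
  · simp
    omega
  · rintro i s' hi ⟨hv, hA, hp, h13, h12⟩
    have hnb : 0 < nb := (Nat.zero_le _).trans_lt hn
    have hL : L ≤ L * nb := Nat.le_mul_of_pos_right _ hnb
    have hs' : Regs n k K N L nb D s' := hs.congr fun y hy => hv y (by omega)
    rw [← hv 8 (by omega)] at h8
    rw [← hv 9 (by omega)] at h9
    rw [← hv 11 (by omega)] at h11
    constructor
    · simp [h13, hs'.r4, hi]
    · have hxK : x / K ≤ n / K := Nat.div_le_div_right hx
      have hzK : z / K ≤ n / K := Nat.div_le_div_right hz
      have b1 : i * nb + nb ≤ L * nb := by nlinarith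
      have b2 : i * D + d < L * D := index_lt hi hd
      have b3 : (i * D + d) * nb + nb ≤ L * D * nb := by nlinarith
      have b4 : i * D + d ≤ (i * D + d) * nb := Nat.le_mul_of_pos_right _ hnb
      have c1 : ∀ u y, y / K ≤ n / K → cut K u y ≤ nb := by
        intro u y hy
        unfold cut
        split_ifs <;> omega
      have m1 : (i * nb) % 2 ^ w = i * nb := Nat.mod_eq_of_lt (by omega)
      have m2 : (i * nb + x / K) % 2 ^ w = i * nb + x / K := Nat.mod_eq_of_lt (by omega)
      have m3 : (i * nb + z / K) % 2 ^ w = i * nb + z / K := Nat.mod_eq_of_lt (by omega)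
      have mc : ∀ u y, y / K ≤ n / K → cut K u y % 2 ^ w = cut K u y := fun u y hy =>
        Nat.mod_eq_of_lt ((c1 u y hy).trans_lt (by omega))
      have mA : ∀ u y, y / K ≤ n / K → (i * nb + cut K u y) % 2 ^ w = i * nb + cut K u y :=
        fun u y hy => Nat.mod_eq_of_lt (by have := c1 u y hy; omega)
      have mB : ∀ u y, y / K ≤ n / K →
          ((i * D + d) * nb + cut K u y) % 2 ^ w = (i * D + d) * nb + cut K u y :=
        fun u y hy => Nat.mod_eq_of_lt (by have := c1 u y hy; omega)
      -- Column `0` of the table is a border, so diagonal `d` sits in column `d + 1`, which is what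
      -- register 8 holds.
      have m5 : (d + 1 + (2 ^ w - 1)) % 2 ^ w = d := by
        rw [show d + 1 + (2 ^ w - 1) = d + 2 ^ w by omega, Nat.add_mod_right,
          Nat.mod_eq_of_lt (by omega)]
      have cx : ∀ y, (y / K + if s.arr 0 (i * nb + y / K) < y % K then 1 else 0) =
        cut K (fun b => s.arr 0 (i * nb + b)) y := fun _ => rfl
      refine .assign_seq (by simp) (.assign_seq (by simp) (.assign_seq (by simp)
        (.assign_seq (by simp) (.assign_seq (by simp) (.assign (by simp)
          ⟨fun x hx => ?_, ?_, ?_, ?_, ?_⟩)))))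
      · simp [show x ≠ 12 by omega, show x ≠ 13 by omega, show x ≠ 14 by omega,
          show x ≠ 15 by omega, show x ≠ 16 by omega, show x ≠ 17 by omega, hv x hx]
      · simp [hA]
      · simp [hp]
      · simp [h13]; apply Nat.mod_eq_of_lt; omega
      · simp [h8, h9, h11, h12, h13, hs'.r2, hs'.r5, hs'.r6, hA, m1, m2, m3, -Nat.mod_add_mod, -Nat.add_mod_mod, m5, cx]
        have m4 : (i * D) % 2 ^ w = i * D := Nat.mod_eq_of_lt (by omega)
        have m6 : ((i * D + d) * nb) % 2 ^ w = (i * D + d) * nb := Nat.mod_eq_of_lt (by omega)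
        have key : AgreeAll w K (i + 1) nb D (s.arr 0) (s.arr 2) (s.arr 1) d x z ↔
            AgreeAll w K i nb D (s.arr 0) (s.arr 2) (s.arr 1) d x z ∧
              Agree w K nb D (s.arr 0) (s.arr 2) (s.arr 1) i d x z := Nat.forall_lt_succ_right
        simp only [m4, m6, mc _ x hxK, mc _ z hzK, mA _ x hxK, mA _ z hzK, mB _ x hxK, mB _ z hzK]
        rw [if_congr key rfl rfl, Nat.mod_eq_of_lt]
        · unfold Agree Nat.ModEq
          split_ifs <;> tauto
        · have := (Fact.out : 64 < 2 ^ w)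
          split_ifs <;> omega
  · rintro s' ⟨hv, hA, hp, h13, h12⟩
    have hs' : Regs n k K N L nb D s' := hs.congr fun y hy => hv y (by omega)
    simp [h13, hs'.r4]
  · rintro s' ⟨hv, hA, hp, h13, h12⟩
    exact ⟨hv, hA, hp, h12⟩

/-- Possible results `v` of advancing from `x`, where `P y z` says that the segment from `y` to `z`
passes all tests. -/
structure Advances (P : ℕ → ℕ → Prop) (n x v : ℕ) : Prop where
  le : x ≤ v
  le_length : v ≤ n
  passes : P x v
  furthest : ∀ t ≤ n, x ≤ t → (∀ y z, x ≤ y → y ≤ z → z ≤ t → P y z) → t ≤ v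

-- Binary search with the jumps `2 ^ l, …, 2, 1`. Passing is not monotone in the end point: a long
-- segment may pass by accident although a part of it fails. The field `furthest` therefore speaks
-- only of end points up to which all subsegments pass; for these a rejected jump is a genuine
-- barrier.
open Classical in
theorem slide_runs {n k K l L nb D d x : ℕ} {s : Store} (hs : Regs n k K (2 ^ l) L nb D s)
    (h8 : s.var 8 = d + 1) (h9 : s.var 9 = x) (hd : d < D) (hx : x ≤ n) (hn : n / K < nb)
    (hw1 : L * D * nb + nb < 2 ^ w) (hw2 : L * nb + nb < 2 ^ w) (hw3 : D < 2 ^ w)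
    (hl : n < 2 ^ l) (hw4 : n + 2 ^ l < 2 ^ w) :
    Runs w inp ω slide s ((l + 2) * (L * 110 + 60)) (fun s' => (∀ y < 9, s'.var y = s.var y) ∧
      s'.arr = s.arr ∧ s'.pos = s.pos ∧
      Advances (AgreeAll w K L nb D (s.arr 0) (s.arr 2) (s.arr 1) d) n x (s'.var 9)) := by
  set P := AgreeAll w K L nb D (s.arr 0) (s.arr 2) (s.arr 1) d with hP
  refine .assign_seq (by simp; nlinarith) ?_
  -- Before round `i` the jumps still to come add up to `2 ^ (l + 1 - i) - 1`; the last conjunct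
  -- says that no such end point lies beyond their reach. Register 10 holds the next jump, and `0`
  -- after the last one.
  refine (Runs.loop (fun i s' => (∀ y < 9, s'.var y = s.var y) ∧
      s'.arr = s.arr ∧ s'.pos = s.pos ∧ s'.var 10 = 2 ^ (l + 1 - i) / 2 ∧ x ≤ s'.var 9 ∧
      s'.var 9 ≤ n ∧ P x (s'.var 9) ∧ ∀ t ≤ n, x ≤ t →
        (∀ y z, x ≤ y → y ≤ z → z ≤ t → P y z) → t < s'.var 9 + 2 ^ (l + 1 - i))
      (l + 1) (L * 110 + 55) ?_ ?_ ?_ ?_).mono le_rfl ?_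
  · refine ⟨fun x hx => ?_, ?_, ?_, ?_, ?_, ?_, ?_, ?_⟩
    · simp [show x ≠ 10 by omega]
    · simp
    · simp
    · simp [hs.r3, pow_succ]
    · simp [h9]
    · simp [h9, hx]
    · simp [h9]; exact AgreeAll.refl
    · intro t ht hxt _
      simp [h9, pow_succ]
      omega
  · have a1 : (l + 2) * (L * 110 + 60) =
      (l + 1) * (2 + (L * 110 + 55)) + (l + 1) * 3 + (L * 110 + 60) := by ring
    simp
    omega
  · rintro i s' hi ⟨hv, hA, hp, h10, hx', hn', hPx, ht⟩
    have hs' : Regs n k K (2 ^ l) L nb D s' := hs.congr fun y hy => hv y (by omega)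
    rw [← hv 8 (by omega)] at h8
    obtain ⟨m, hm⟩ : ∃ m, l - i = m := ⟨_, rfl⟩
    have hm1 : l + 1 - i = m + 1 := by omega
    have hm2 : l + 1 - (i + 1) = m := by omega
    have hml : 2 ^ m ≤ 2 ^ l := Nat.pow_le_pow_right (by omega) (by omega)
    have h10' : s'.var 10 = 2 ^ m := by rw [h10, hm1, pow_succ]; simp
    rw [hm1] at ht
    rw [hm2]
    constructor
    · simp [h10']
    · have e1 : (s'.var 9 + 2 ^ m) % 2 ^ w = s'.var 9 + 2 ^ m := Nat.mod_eq_of_lt (by omega)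
      have e2 : (n + 1) % 2 ^ w = n + 1 := Nat.mod_eq_of_lt (by omega)
      refine .assign_seq (by simp) ?_
      refine .seq (L * 110 + 45) (by simp) ((?_ : Runs w inp ω _ _ _ (fun s₁ =>
        (∀ y < 9, s₁.var y = s.var y) ∧ s₁.arr = s.arr ∧ s₁.pos = s.pos ∧ s₁.var 10 = 2 ^ m ∧
        x ≤ s₁.var 9 ∧ s₁.var 9 ≤ n ∧ P x (s₁.var 9) ∧ ∀ t ≤ n, x ≤ t →
        (∀ y z, x ≤ y → y ≤ z → z ≤ t → P y z) → t < s₁.var 9 + 2 ^ m)).mono le_rfl ?_)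
      · refine .ite (by simp) (fun h => ?_) (fun h => ?_)
        · simp [hs'.r0, h10', e1, e2] at h
          refine .seq (L * 110 + 20) (by simp) ((compareHashes_runs (d := d)
            (x := s'.var 9) (z := s'.var 9 + 2 ^ m) (hs'.congr fun y hy => ?_) ?_ ?_ ?_
            hd hn' ?_ hn hw1 hw2 hw3).mono le_rfl ?_)
          · simp [show y ≠ 11 by omega]
          · simpa using h8
          · simp
          · simp [h10', e1]
          · omega
          rintro s₁ ⟨hv₁, hA₁, hp₁, h12⟩
          have h12' : s₁.var 12 = if P (s'.var 9) (s'.var 9 + 2 ^ m) then 1 else 0 := by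
            rw [h12]
            simp only [hA]
            rfl
          have hA₁' : s₁.arr = s.arr := by rw [hA₁, hA]
          have h9₁ : s₁.var 9 = s'.var 9 := by simp [hv₁ 9 (by omega)]
          have h10₁ : s₁.var 10 = 2 ^ m := by simp [hv₁ 10 (by omega), h10']
          have h11₁ : s₁.var 11 = s'.var 9 + 2 ^ m := by simp [hv₁ 11 (by omega), h10', e1]
          have hv₁' : ∀ y < 9, s₁.var y = s.var y := fun y hy => by
            simp [hv₁ y (by omega), hv y hy, show y ≠ 11 by omega]
          simp only at hp₁
          refine .ite (by simp) (fun h' => ?_) (fun h' => ?_)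
          · have hPz : P (s'.var 9) (s'.var 9 + 2 ^ m) := by
              by_contra hcon
              simp [h12', hcon] at h'
            refine .assign (by simp) ⟨fun y hy => ?_, ?_, ?_, ?_, ?_, ?_, ?_, ?_⟩
            · simp [show y ≠ 9 by omega, hv₁' y hy]
            · simp [hA₁']
            · simp [hp₁, hp]
            · simp [h10₁]
            · simp [h11₁]; omega
            · simp [h11₁]; omega
            · simpa [h11₁] using hPx.trans hPz
            · intro t htn hxt hall
              have := ht t htn hxt hall
              rw [pow_succ] at this
              simp [h11₁]
              omega
          · have hPz : ¬ P (s'.var 9) (s'.var 9 + 2 ^ m) := by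
              intro hcon
              simp [h12', hcon] at h'
            refine .skip (by simp) ⟨hv₁', hA₁', hp₁.trans hp, h10₁, ?_, ?_, ?_, ?_⟩
            · rwa [h9₁]
            · rwa [h9₁]
            · rwa [h9₁]
            · intro t htn hxt hall
              rw [h9₁]
              by_contra! hcon
              exact hPz (hall _ _ hx' (by omega) hcon)
        · simp [hs'.r0, h10', e1, e2] at h
          refine .skip (by simp) ⟨fun y hy => ?_, hA, hp, ?_, ?_, ?_, ?_, ?_⟩
          · simp [show y ≠ 11 by omega, hv y hy]
          · simp [h10']
          · simpa using hx'
          · simpa using hn'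
          · simpa using hPx
          · intro t htn hxt hall
            simp
            omega
      · rintro s₁ ⟨hv₁, hA₁, hp₁, h10₁, h1, h2, h3, h4⟩
        refine .assign (by simp) ⟨fun y hy => ?_, hA₁, hp₁, ?_, ?_, ?_, ?_, ?_⟩
        · simp [show y ≠ 10 by omega, hv₁ y hy]
        · simp [h10₁]
        · simpa using h1
        · simpa using h2
        · simpa using h3
        · simpa using h4
  · rintro s' ⟨hv, hA, hp, h10, -⟩
    simpa using h10
  · rintro s' ⟨hv, hA, hp, h10, hx', hn', hPx, ht⟩
    refine ⟨hv, hA, hp, hx', hn', hPx, fun t htn hxt hall => ?_⟩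
    have := ht t htn hxt hall
    simp at this
    omega

theorem raise_seq {x : ℕ} {e : Expr} {d : Cmd} {s : Store} {T : ℕ} {Q : Store → Prop}
    (hT : 2 * e.cost + 4 ≤ T)
    (h : Runs w inp ω d
      { s with var := Function.update s.var x (max (s.var x) (e.eval w inp s)) }
      (T - (2 * e.cost + 4)) Q) :
    Runs w inp ω (raise x e ;; d) s T Q := by
  refine .seq _ hT (.ite (by simp; omega) (fun h' => ?_) (fun h' => ?_))
  · have hlt : s.var x < e.eval w inp s := by
      by_contra hc
      simp [hc] at h'
    rw [max_eq_right hlt.le] at h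
    exact .assign (by simp; omega) h
  · have hle : e.eval w inp s ≤ s.var x := by
      by_contra hc
      simp [not_le.1 hc] at h'
    rw [max_eq_left hle, Function.update_eq_self] at h
    exact .skip (by simp; omega) h

/-- The position from which to advance, given by the table entries for one edit less. -/
def candidate (n : ℕ) (T : ℕ → ℕ) (q : ℕ) : ℕ :=
  min n (max (max (T q + 1) (T (q + 1) + 1)) (T (q - 1)))

/-- The table is stored by rows of length `D + 1`. The zero border in column `0` serves both sides:
it is the left neighbour of the first diagonal, and column `0` of the next row is the right
neighbour of the last one. -/
theorem fillTable_runs {n k K l L nb D : ℕ} {s : Store} (hs : Regs n k K (2 ^ l) L nb D s)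
    (h3 : ∀ q, s.arr 3 q = 0) (hn : n / K < nb)
    (hw1 : L * D * nb + nb < 2 ^ w) (hw2 : L * nb + nb < 2 ^ w) (hw3 : D + 1 < 2 ^ w)
    (hl : n < 2 ^ l) (hw4 : n + 2 ^ l < 2 ^ w) (hw5 : (k + 2) * (D + 1) + 1 < 2 ^ w) :
    Runs w inp ω fillTable s ((k + 1) * (D + 1) * ((l + 2) * (L * 110 + 60) + 100) + 20)
      (fun s' => Regs n k K (2 ^ l) L nb D s' ∧
        (∀ p, p < D + 1 ∨ p % (D + 1) = 0 → s'.arr 3 p = 0) ∧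
        ∀ p < (k + 1) * (D + 1), p % (D + 1) ≠ 0 →
          Advances (AgreeAll w K L nb D (s.arr 0) (s.arr 2) (s.arr 1) (p % (D + 1) - 1)) n
            (candidate n (s'.arr 3) p) (s'.arr 3 (p + (D + 1)))) := by
  refine .assign_seq (by simp) ?_
  have e1 : (D + 1) % 2 ^ w = D + 1 := Nat.mod_eq_of_lt (by omega)
  have hmul : (k + 2) * (D + 1) = (k + 1) * (D + 1) + (D + 1) := by ring
  refine (Runs.loop (fun i s' => Regs n k K (2 ^ l) L nb D s' ∧ s'.var 7 = i ∧
      (∀ b ≠ 3, s'.arr b = s.arr b) ∧ (∀ p, s'.arr 3 p ≤ n) ∧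
      (∀ p, p < D + 1 ∨ p % (D + 1) = 0 ∨ i + (D + 1) ≤ p → s'.arr 3 p = 0) ∧
        ∀ p < i, p % (D + 1) ≠ 0 →
          Advances (AgreeAll w K L nb D (s.arr 0) (s.arr 2) (s.arr 1) (p % (D + 1) - 1)) n
            (candidate n (s'.arr 3) p) (s'.arr 3 (p + (D + 1))))
      ((k + 1) * (D + 1)) ((l + 2) * (L * 110 + 60) + 85) ?_ ?_ ?_ ?_).mono le_rfl ?_
  · refine ⟨hs.congr fun x hx => ?_, ?_, ?_, ?_, ?_, ?_⟩
    · simp [show x ≠ 7 by omega]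
    · simp
    · simp
    · simp [h3]
    · simp [h3]
    · simp
  · simp
    nlinarith
  · rintro i s' hi ⟨hs', h7, hA, hTn, hT0, hT⟩
    constructor
    · simp [h7, hs'.r1, hs'.r6]
      rw [Nat.mod_eq_of_lt (by omega)]
      omega
    · refine .assign_seq (by simp) ?_
      refine .seq ((l + 2) * (L * 110 + 60) + 70) (by simp) ((?_ : Runs w inp ω _ _ _
        (fun s' => Regs n k K (2 ^ l) L nb D s' ∧ s'.var 7 = i ∧
      (∀ b ≠ 3, s'.arr b = s.arr b) ∧ (∀ p, s'.arr 3 p ≤ n) ∧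
      (∀ p, p < D + 1 ∨ p % (D + 1) = 0 ∨ i + 1 + (D + 1) ≤ p → s'.arr 3 p = 0) ∧
        ∀ p < i + 1, p % (D + 1) ≠ 0 →
          Advances (AgreeAll w K L nb D (s.arr 0) (s.arr 2) (s.arr 1) (p % (D + 1) - 1)) n
            (candidate n (s'.arr 3) p) (s'.arr 3 (p + (D + 1))))).mono le_rfl ?_)
      · refine .ite (by simp) (fun h => ?_) (fun h => ?_)
        · simp [h7, hs'.r6, e1] at h
          have hi0 : i ≠ 0 := by rintro rfl; simp at h
          have hid : i % (D + 1) < D + 1 := Nat.mod_lt _ (by omega)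
          refine .assign_seq (by simp) (raise_seq (by simp)
            (raise_seq (by simp) ?_))
          refine .seq 10 (by simp) ((?_ : Runs w inp ω _ _ _ (fun s₂ =>
            Regs n k K (2 ^ l) L nb D s₂ ∧ s₂.var 7 = i ∧ s₂.var 8 = i % (D + 1) ∧
            s₂.arr = s'.arr ∧ s₂.var 9 = candidate n (s'.arr 3) i)).mono le_rfl ?_)
          · have f1 : (i + 1) % 2 ^ w = i + 1 := Nat.mod_eq_of_lt (by omega)
            have f2 : (i + (2 ^ w - 1)) % 2 ^ w = i - 1 := by
              rw [show i + (2 ^ w - 1) = i - 1 + 2 ^ w by omega, Nat.add_mod_right,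
                Nat.mod_eq_of_lt (by omega)]
            have f3 : ∀ q, (s'.arr 3 q + 1) % 2 ^ w = s'.arr 3 q + 1 := fun q =>
              Nat.mod_eq_of_lt (by have := hTn q; omega)
            refine .ite (by simp) (fun h' => ?_) (fun h' => ?_)
            · simp [h7, hs'.r0, f1, f2, f3] at h'
              refine .assign (by simp) ⟨hs'.congr fun y hy => ?_, ?_, ?_, ?_, ?_⟩
              · simp [show y ≠ 8 by omega, show y ≠ 9 by omega]
              · simp [h7]
              · simp [h7, hs'.r6, e1]
              · simp
              · simp [hs'.r0, candidate]; omega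
            · simp [h7, hs'.r0, f1, f2, f3] at h'
              refine .skip (by simp) ⟨hs'.congr fun y hy => ?_, ?_, ?_, ?_, ?_⟩
              · simp [show y ≠ 8 by omega, show y ≠ 9 by omega]
              · simp [h7]
              · simp [h7, hs'.r6, e1]
              · simp
              · simp [h7, f1, f2, f3, candidate]; omega
          rintro s₂ ⟨hs₂, h7₂, h8₂, hA₂, h9₂⟩
          refine .seq ((l + 2) * (L * 110 + 60)) (by simp) ((slide_runs
            (d := i % (D + 1) - 1) hs₂ (by omega) h9₂ (by omega) (min_le_left _ _) hn hw1 hw2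
            (by omega) hl hw4).mono le_rfl ?_)
          rintro s₃ ⟨hv₃, hA₃, hp₃, hadv⟩
          rw [hA₂, hA 0 (by simp), hA 1 (by simp), hA 2 (by simp)] at hadv
          rw [hA₂] at hA₃
          have hs₃ : Regs n k K (2 ^ l) L nb D s₃ := hs₂.congr fun y hy => hv₃ y (by omega)
          have h7₃ : s₃.var 7 = i := (hv₃ 7 (by omega)).trans h7₂
          have f4 : (i + (D + 1)) % 2 ^ w = i + (D + 1) := Nat.mod_eq_of_lt (by omega)
          refine .store (by simp) ⟨hs₃.congr fun y hy => rfl, h7₃, fun b hb => ?_,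
            fun p => ?_, fun p hp => ?_, fun p hp hp0 => ?_⟩
          · simp [hb, hA₃, hA b hb]
          · by_cases hp : p = i + (D + 1)
            · simp [h7₃, hs₃.r6, e1, f4, hp, hadv.le_length]
            · simp [h7₃, hs₃.r6, e1, f4, hp, hA₃, hTn p]
          · have hne : p ≠ i + (D + 1) := by
              rintro rfl
              simp at hp
              omega
            simp [h7₃, hs₃.r6, e1, f4, hne, hA₃]
            exact hT0 p (by omega)
          -- The cell being written lies beyond all cells that the recurrence has read so far,
          -- because a row has at least two cells.
          · have hne : ∀ q ≤ i + 1, q ≠ i + (D + 1) := fun q hq => by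
              rintro rfl
              have : D = 0 := by omega
              simp [this, Nat.mod_one] at h
            have hcand : candidate n (Function.update (s'.arr 3) (i + (D + 1)) (s₃.var 9)) p =
                candidate n (s'.arr 3) p := by
              unfold candidate
              rw [Function.update_of_ne (hne p (by omega)),
                Function.update_of_ne (hne (p + 1) (by omega)),
                Function.update_of_ne (hne (p - 1) (by omega))]
            simp [h7₃, hs₃.r6, e1, f4, hA₃, hcand]
            by_cases hpi : p = i
            · subst hpi
              simpa using hadv
            · rw [Function.update_of_ne (by omega)]
              exact hT p (by omega) hp0
        · simp [h7, hs'.r6, e1] at h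
          refine .skip (by simp) ⟨hs'.congr fun y hy => ?_, h7, hA, hTn, ?_, ?_⟩
          · simp [show y ≠ 8 by omega]
          · intro p hp
            exact hT0 p (by omega)
          · intro p hp hp0
            refine hT p (lt_of_le_of_ne (by omega) ?_) hp0
            rintro rfl
            exact hp0 h
      · rintro s₁ ⟨hs₁, h7₁, hA₁, hTn₁, hT0₁, hT₁⟩
        refine .assign (by simp) ⟨hs₁.congr fun y hy => ?_, ?_, hA₁, hTn₁, hT0₁, hT₁⟩
        · simp [show y ≠ 7 by omega]
        · simp [h7₁]
          apply Nat.mod_eq_of_lt; omega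
  · rintro s' ⟨hs', h7, -⟩
    simp [h7, hs'.r1, hs'.r6]
    rw [Nat.mod_eq_of_lt (by omega)]
  · rintro s' ⟨hs', h7, hA, hTn, hT0, hT⟩
    exact ⟨hs', fun p hp => hT0 p (by tauto), hT⟩

end GapEdit

namespace GapEdit

/-! ### Upper bounds for the edit distance -/

section Within

variable {α β : Type*} {m m' : ℕ} {u v x : List α}

/-- At most `m` edit steps lead from `u` to `v`. -/
def Within (m : ℕ) (u v : List α) : Prop := ∃ m' ≤ m, EditSteps m' u v

theorem EditSteps.trans (h : EditSteps m u v) (h' : EditSteps m' v x) :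
    EditSteps (m + m') u x := by
  induction h with
  | refl => simpa using h'
  | step hs _ ih =>
    rw [Nat.add_right_comm]
    exact .step hs (ih h')

theorem EditStep.append_right (h : EditStep u v) (y : List α) : EditStep (u ++ y) (v ++ y) := by
  cases h with
  | ins p q a => simpa using EditStep.ins p (q ++ y) a
  | del p q a => simpa using EditStep.del p (q ++ y) a
  | sub p q a b => simpa using EditStep.sub p (q ++ y) a b

theorem EditSteps.append_right (h : EditSteps m u v) (y : List α) :
    EditSteps m (u ++ y) (v ++ y) := by
  induction h with
  | refl => exact .refl _
  | step hs _ ih => exact .step (hs.append_right y) ih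

theorem EditSteps.map (f : α → β) (h : EditSteps m u v) : EditSteps m (u.map f) (v.map f) := by
  induction h with
  | refl => exact .refl _
  | step hs _ ih =>
    refine .step ?_ ih
    cases hs with
    | ins p q a => simpa using EditStep.ins (p.map f) (q.map f) (f a)
    | del p q a => simpa using EditStep.del (p.map f) (q.map f) (f a)
    | sub p q a b => simpa using EditStep.sub (p.map f) (q.map f) (f a) (f b)

theorem Within.mono (h : Within m u v) (hm : m ≤ m') : Within m' u v :=
  let ⟨l, hl, h⟩ := h; ⟨l, hl.trans hm, h⟩

theorem Within.refl (u : List α) : Within m u u := ⟨0, by omega, .refl u⟩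

theorem Within.trans (h : Within m u v) (h' : Within m' v x) : Within (m + m') u x :=
  let ⟨_, hl, h⟩ := h; let ⟨_, hl', h'⟩ := h'; ⟨_, by omega, h.trans h'⟩

theorem EditStep.within (h : EditStep u v) : Within 1 u v := ⟨1, le_rfl, .step h (.refl v)⟩

theorem Within.snoc (h : Within m u v) (a : α) : Within m (u ++ [a]) (v ++ [a]) :=
  let ⟨l, hl, h⟩ := h; ⟨l, hl, h.append_right [a]⟩

theorem Within.snoc_sub (h : Within m u v) (a b : α) : Within (m + 1) (u ++ [a]) (v ++ [b]) :=
  (h.snoc a).trans (EditStep.sub v [] a b).within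

theorem Within.snoc_left (h : Within m u v) (a : α) : Within (m + 1) (u ++ [a]) v := by
  simpa using (h.snoc a).trans (EditStep.del v [] a).within

theorem Within.snoc_right (h : Within m u v) (a : α) : Within (m + 1) u (v ++ [a]) := by
  have h' := (EditStep.ins v [] a).within
  rw [List.append_nil] at h'
  exact h.trans h'

theorem Within.of_snoc_right {a : α} (h : Within m u (v ++ [a])) : Within (m + 1) u v := by
  have h' := (EditStep.del v [] a).within
  rw [List.append_nil] at h'
  exact h.trans h'

theorem within_append_left (u v : List α) : Within u.length (u ++ v) v := by
  induction u with
  | nil => exact .refl v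
  | cons a u ih =>
    have := (EditStep.del [] (u ++ v) a).within.trans ih
    rwa [Nat.add_comm] at this

theorem within_append_right (u v : List α) : Within u.length v (u ++ v) := by
  induction u with
  | nil => exact .refl v
  | cons a u ih => exact ih.trans (EditStep.ins [] (u ++ v) a).within

theorem Within.map (f : α → β) (h : Within m u v) : Within m (u.map f) (v.map f) :=
  let ⟨l, hl, h⟩ := h; ⟨l, hl, h.map f⟩

theorem Within.editDist_le (h : Within m u v) : editDist u v ≤ m :=
  let ⟨_, hl, h⟩ := h; (Nat.sInf_le h).trans hl

end Within

/-! ### Alignments -/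

/-- `Align m u v`: the strings have an alignment of cost at most `m`. -/
inductive Align {α : Type*} : ℕ → List α → List α → Prop
  | nil (m : ℕ) : Align m [] []
  | cons {m : ℕ} {u v : List α} (a : α) : Align m u v → Align m (a :: u) (a :: v)
  | sub {m : ℕ} {u v : List α} (a b : α) : Align m u v → Align (m + 1) (a :: u) (b :: v)
  | del {m : ℕ} {u v : List α} (a : α) : Align m u v → Align (m + 1) (a :: u) v
  | ins {m : ℕ} {u v : List α} (b : α) : Align m u v → Align (m + 1) u (b :: v)

namespace Align

variable {α : Type*} {m : ℕ} {u v x : List α}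

theorem refl (m : ℕ) (u : List α) : Align m u u := by
  induction u with
  | nil => exact .nil m
  | cons a u ih => exact .cons a ih

theorem succ (h : Align m u v) : Align (m + 1) u v := by
  induction h with
  | nil m => exact .nil _
  | cons a _ ih => exact .cons a ih
  | sub a b _ ih => exact .sub a b ih
  | del a _ ih => exact .del a ih
  | ins b _ ih => exact .ins b ih

theorem tail {a : α} (h : Align m (a :: u) x) : Align (m + 1) u x := by
  generalize hy : a :: u = y at h
  induction h with
  | nil m => cases hy
  | cons a h ih => cases hy; exact .ins _ h
  | sub a b h ih => cases hy; exact (h.ins _).succ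
  | del a h ih => cases hy; exact h.succ.succ
  | ins b h ih => exact .ins _ (ih hy)

theorem replace_head {a : α} (b : α) (h : Align m (a :: u) x) : Align (m + 1) (b :: u) x := by
  generalize hy : a :: u = y at h
  induction h with
  | nil m => cases hy
  | cons a h ih => cases hy; exact .sub _ _ h
  | sub a c h ih => cases hy; exact (h.sub _ _).succ
  | del a h ih => cases hy; exact (h.del _).succ
  | ins b h ih => exact .ins _ (ih hy)

/-- The alignment may insert characters before it consumes the head `a`; the induction walks through
these insertions and applies `H` to what follows `a`. -/
theorem cons_congr {a : α} (H : ∀ m x, Align m v x → Align (m + 1) u x)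
    (h : Align m (a :: v) x) : Align (m + 1) (a :: u) x := by
  generalize hy : a :: v = y at h
  induction h with
  | nil m => cases hy
  | cons a h ih => cases hy; exact .cons _ (H _ _ h)
  | sub a c h ih => cases hy; exact .sub _ _ (H _ _ h)
  | del a h ih => cases hy; exact .del _ (H _ _ h)
  | ins b h ih => exact .ins _ (ih hy)

theorem append_congr (H : ∀ m x, Align m v x → Align (m + 1) u x) (p : List α) :
    ∀ m x, Align m (p ++ v) x → Align (m + 1) (p ++ u) x := by
  induction p with
  | nil => exact H
  | cons a p ih => exact fun m x h => cons_congr ih h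

/-- Edits come in any order, an alignment reads from left to right. Prefixing one edit to an
alignment raises its cost by at most one: `tail`, `del` and `replace_head` treat the edited place,
and `append_congr` carries them past the untouched prefix. -/
theorem of_editSteps (h : EditSteps m u v) : Align m u v := by
  induction h with
  | refl u => exact refl 0 u
  | step hs _ ih =>
    cases hs with
    | ins p q a => exact append_congr (fun _ _ h => h.tail) p _ _ ih
    | del p q a => exact append_congr (fun _ _ h => h.del a) p _ _ ih
    | sub p q a b => exact append_congr (fun _ _ h => h.replace_head a) p _ _ ih

theorem of_editDist_le (h : editDist u v ≤ m) : Align m u v := by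
  have h' : Align (editDist u v) u v := of_editSteps (Nat.sInf_mem (exists_editSteps u v))
  exact Nat.le_induction h' (fun _ _ ih => ih.succ) m h

end Align

/-! ### The table of furthest reaching positions -/

/-- The characters of `b` in the cells `i, …, j - 1`. -/
def segment (b : ℕ → ℕ) (i j : ℕ) : List ℕ := (List.range' i (j - i)).map b

theorem segment_self (b : ℕ → ℕ) (i : ℕ) : segment b i i = [] := by simp [segment]

theorem segment_succ (b : ℕ → ℕ) {i j : ℕ} (h : i ≤ j) :
    segment b i (j + 1) = segment b i j ++ [b j] := by
  rw [segment, Nat.succ_sub h, List.range'_concat, List.map_append]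
  simp [segment, h]

theorem segment_cons (b : ℕ → ℕ) {i j : ℕ} (h : i < j) :
    segment b i j = b i :: segment b (i + 1) j := by
  rw [segment, show j - i = (j - (i + 1)) + 1 by omega, List.range'_succ]
  simp [segment]

theorem segment_append (b : ℕ → ℕ) {i j l : ℕ} (h : i ≤ j) (h' : j ≤ l) :
    segment b i l = segment b i j ++ segment b j l := by
  induction l, h' using Nat.le_induction with
  | base => simp [segment_self]
  | succ l hl ih => rw [segment_succ b (h.trans hl), segment_succ b hl, ih, List.append_assoc]

theorem segment_length (b : ℕ → ℕ) (i j : ℕ) : (segment b i j).length = j - i := by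
  simp [segment]

/-- The number of mismatches between `a` and `b` in the cells `x, …, z - 1`, on the diagonal `d`. -/
def mismatches (a b : ℕ → ℕ) (d x z : ℕ) : ℕ :=
  ((Finset.Ico x z).filter fun s => a s ≠ b (s + d)).card

/-- The prefix of `a` of length `i` can be edited with cost `c` into a segment of `b` that begins in
one of the first `D` cells and ends on the diagonal `d`. -/
def Reached (a b : ℕ → ℕ) (D c d i : ℕ) : Prop :=
  ∃ d₀ < D, d₀ ≤ i + d ∧ Within c (segment a 0 i) (segment b d₀ (i + d))

section Reached

variable {a b : ℕ → ℕ} {D c d i : ℕ}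

theorem Reached.mono {c' : ℕ} (h : Reached a b D c d i) (hc : c ≤ c') : Reached a b D c' d i :=
  let ⟨d₀, h₀, hi, h⟩ := h; ⟨d₀, h₀, hi, h.mono hc⟩

theorem Reached.sub (h : Reached a b D c d i) : Reached a b D (c + 1) d (i + 1) := by
  obtain ⟨d₀, h₀, hi, h⟩ := h
  refine ⟨d₀, h₀, by omega, ?_⟩
  rw [segment_succ a (Nat.zero_le i), Nat.add_right_comm, segment_succ b hi]
  exact h.snoc_sub _ _

theorem Reached.match (h : Reached a b D c d i) (he : a i = b (i + d)) :
    Reached a b D c d (i + 1) := by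
  obtain ⟨d₀, h₀, hi, h⟩ := h
  refine ⟨d₀, h₀, by omega, ?_⟩
  rw [segment_succ a (Nat.zero_le i), Nat.add_right_comm, segment_succ b hi, he]
  exact h.snoc _

theorem Reached.del (h : Reached a b D c (d + 1) i) : Reached a b D (c + 1) d (i + 1) := by
  obtain ⟨d₀, h₀, hi, h⟩ := h
  refine ⟨d₀, h₀, by omega, ?_⟩
  rw [segment_succ a (Nat.zero_le i), Nat.add_right_comm]
  exact h.snoc_left _

theorem Reached.ins (h : Reached a b D c d i) : Reached a b D (c + 1) (d + 1) i := by
  obtain ⟨d₀, h₀, hi, h⟩ := h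
  refine ⟨d₀, h₀, by omega, ?_⟩
  rw [← Nat.add_assoc, segment_succ b hi]
  exact h.snoc_right _

/-- Drops the last character of the segment of `b`. It replaces a deletion where the table is
clipped at `n` and `a` has no further character; an empty segment becomes an empty one that begins a
cell earlier. -/
theorem Reached.unins (h : Reached a b D c (d + 1) i) : Reached a b D (c + 1) d i := by
  obtain ⟨d₀, h₀, hi, h⟩ := h
  rcases Nat.lt_or_ge (i + d) d₀ with hlt | hle
  · obtain rfl : d₀ = i + (d + 1) := by omega
    refine ⟨i + d, by omega, le_rfl, (?_ : Within c _ _).mono (Nat.le_succ c)⟩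
    rw [segment_self] at h ⊢
    exact h
  · refine ⟨d₀, h₀, hle, ?_⟩
    rw [← Nat.add_assoc, segment_succ b hle] at h
    exact h.of_snoc_right

/-- A match is free, a mismatch is paid for by a substitution. -/
theorem Reached.slide {x z : ℕ} (h : Reached a b D c d x) (hxz : x ≤ z) :
    Reached a b D (c + mismatches a b d x z) d z := by
  induction z, hxz using Nat.le_induction with
  | base => exact h.mono (Nat.le_add_right _ _)
  | succ z hxz ih =>
    have hs : mismatches a b d x (z + 1) =
        mismatches a b d x z + if a z ≠ b (z + d) then 1 else 0 := by
      unfold mismatches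
      rw [← Finset.insert_Ico_right_eq_Ico_add_one hxz, Finset.filter_insert]
      split_ifs with hz
      · rw [Finset.card_insert_of_notMem (by simp)]
      · rfl
    rw [hs]
    by_cases hz : a z = b (z + d)
    · simpa [hz] using ih.match hz
    · simpa [hz, Nat.add_assoc] using ih.sub

end Reached

section Table

variable {a b T : ℕ → ℕ} {P : ℕ → ℕ → ℕ → Prop} {n k K : ℕ}

/-- The recurrence satisfied by the table. -/
structure IsTable (P : ℕ → ℕ → ℕ → Prop) (n k : ℕ) (T : ℕ → ℕ) : Prop where
  zero : ∀ p, p < k + k + 2 ∨ p % (k + k + 2) = 0 → T p = 0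
  step : ∀ p < (k + 1) * (k + k + 2), p % (k + k + 2) ≠ 0 →
    Advances (P (p % (k + k + 2) - 1)) n (candidate n T p) (T (p + (k + k + 2)))

theorem IsTable.advances (h : IsTable P n k T) {e d : ℕ} (he : e ≤ k) (hd : d < k + k + 1) :
    Advances (P d) n (candidate n T (e * (k + k + 2) + (d + 1)))
      (T ((e + 1) * (k + k + 2) + (d + 1))) := by
  have h1 : (e * (k + k + 2) + (d + 1)) % (k + k + 2) = d + 1 := by
    rw [Nat.add_comm, Nat.add_mul_mod_self_right, Nat.mod_eq_of_lt (by omega)]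
  have h2 := h.step (e * (k + k + 2) + (d + 1)) (index_lt (by omega) (by omega)) (by omega)
  rw [h1, show e * (k + k + 2) + (d + 1) + (k + k + 2) = (e + 1) * (k + k + 2) + (d + 1) by ring]
    at h2
  exact h2

/-- Each row costs at most `K`: one edit to get to the candidate, and fewer than `K` mismatches
overlooked by the slide. Row `0` is free, since every diagonal may begin with its own empty segment
of `b`. -/
theorem IsTable.reached (h : IsTable P n k T)
    (hP : ∀ d < k + k + 1, ∀ x z, x ≤ z → z ≤ n → P d x z → mismatches a b d x z < K) (e : ℕ) :
    e ≤ k + 1 → ∀ d < k + k + 1, T (e * (k + k + 2) + (d + 1)) ≤ n ∧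
      Reached a b (k + k + 1) (e * K) d (T (e * (k + k + 2) + (d + 1))) := by
  induction e with
  | zero =>
    intro _ d hd
    rw [h.zero _ (Or.inl (by omega))]
    refine ⟨by omega, d, hd, by omega, ?_⟩
    rw [Nat.zero_add, segment_self, segment_self]
    exact .refl _
  | succ e ih =>
    intro he d hd
    have hadv := h.advances (show e ≤ k by omega) hd
    have ih := ih (by omega)
    refine ⟨hadv.le_length, ?_⟩
    have hx : Reached a b (k + k + 1) (e * K + 1) d
        (candidate n T (e * (k + k + 2) + (d + 1))) := by
      set q := e * (k + k + 2) + (d + 1) with hq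
      obtain ⟨hn, h0⟩ : T q ≤ n ∧ Reached a b (k + k + 1) (e * K) d (T q) := ih d hd
      -- A border cell stands for no alignment, hence the guard `0 < T (q + 1)`; a neighbour that
      -- wins the maximum below is positive, so the guard is met.
      have hplus : T (q + 1) ≤ n ∧ (0 < T (q + 1) → Reached a b (k + k + 1) (e * K) (d + 1)
          (T (q + 1))) := by
        by_cases hd' : d + 1 < k + k + 1
        · obtain ⟨h1, h2⟩ := ih (d + 1) hd'
          exact ⟨h1, fun _ => h2⟩
        · have hz : T (q + 1) = 0 := by
            refine h.zero _ (Or.inr ?_)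
            rw [show q + 1 = (e + 1) * (k + k + 2) by rw [hq]; ring_nf; omega]
            exact Nat.mul_mod_left _ _
          omega
      have hminus : T (q - 1) ≤ n ∧ (0 < T (q - 1) → Reached a b (k + k + 1) (e * K + 1) d
          (T (q - 1))) := by
        cases d with
        | zero =>
          have hz : T (q - 1) = 0 := by
            refine h.zero _ (Or.inr ?_)
            rw [show q - 1 = e * (k + k + 2) by omega]
            exact Nat.mul_mod_left _ _
          omega
        | succ d =>
          obtain ⟨h1, h2⟩ := ih d (by omega)
          rw [show q - 1 = e * (k + k + 2) + (d + 1) by omega]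
          exact ⟨h1, fun _ => h2.ins⟩
      unfold candidate
      rcases Nat.lt_or_ge (T q) (T (q + 1)) with h1 | h1
      · rcases Nat.lt_or_ge (T (q + 1) + 1) (T (q - 1)) with h2 | h2
        · rw [max_eq_right (by omega), min_eq_right (by omega)]
          exact hminus.2 (by omega)
        · rw [max_eq_left (by omega), max_eq_right (by omega)]
          rcases Nat.lt_or_ge (T (q + 1)) n with h3 | h3
          · rw [min_eq_right (by omega)]
            exact (hplus.2 (by omega)).del
          · rw [min_eq_left (by omega), show n = T (q + 1) by omega]
            exact (hplus.2 (by omega)).unins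
      · rw [max_eq_left (by omega : T (q + 1) + 1 ≤ T q + 1)]
        rcases Nat.lt_or_ge (T q + 1) (T (q - 1)) with h2 | h2
        · rw [max_eq_right (by omega), min_eq_right (by omega)]
          exact hminus.2 (by omega)
        · rw [max_eq_left (by omega)]
          rcases Nat.lt_or_ge (T q) n with h3 | h3
          · rw [min_eq_right (by omega)]
            exact h0.sub
          · rw [min_eq_left (by omega), show n = T q by omega]
            exact h0.mono (Nat.le_succ _)
    have := hP d hd _ _ hadv.le hadv.le_length hadv.passes
    refine (hx.slide hadv.le).mono ?_
    have := Nat.add_one_mul e K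
    omega

/-- If the table reaches the end of the strings, their edit distance is small. -/
theorem IsTable.sound (h : IsTable P n k T)
    (hP : ∀ d < k + k + 1, ∀ x z, x ≤ z → z ≤ n → P d x z → mismatches a b d x z < K)
    (hT : T ((k + 1) * (k + k + 2) + (k + 1)) = n) :
    Within ((k + 1) * K + k) (segment a 0 n) (segment b k (n + k)) := by
  obtain ⟨-, d₀, h₀, hi, hw⟩ := h.reached hP (k + 1) le_rfl k (by omega)
  rw [hT] at hi hw
  -- The segment of `b` begins at some `d₀ ≤ 2 * k`; moving its beginning to `k` takes at most `k`
  -- insertions or deletions.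
  rcases Nat.lt_or_ge k d₀ with hlt | hle
  · refine hw.trans ?_
    rw [segment_append b hlt.le hi]
    refine (within_append_right _ _).mono ?_
    rw [segment_length]
    omega
  · refine hw.trans ?_
    rw [segment_append b hle (Nat.le_add_left k n)]
    refine (within_append_left _ _).mono ?_
    rw [segment_length]
    omega

/-- Follows an alignment through the table. After `e` edits it stands at position `i` on diagonal
`d`, which is within `e` of the main diagonal `k`, and its current run of matches began at `i₀`. The
candidate is at least `i₀`, so either it is already past `i` or what remains of the run is matched
and the slide covers it; thus row `e + 1` reaches `i`, and the next edit leads to a candidate in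
that row. -/
theorem IsTable.le_of_align (h : IsTable P n k T)
    (hP : ∀ d < k + k + 1, ∀ x z, x ≤ z → z ≤ n → (∀ s, x ≤ s → s < z → a s = b (s + d)) → P d x z)
    {m : ℕ} {u v : List ℕ} (hA : Align m u v) :
    ∀ i d e i₀, u = segment a i n → v = segment b (i + d) (n + k) → i ≤ n → i + d ≤ n + k →
      k ≤ d + e → d ≤ k + e → e + m ≤ k → i₀ ≤ i →
      i₀ ≤ candidate n T (e * (k + k + 2) + (d + 1)) →
      (∀ s, i₀ ≤ s → s < i → a s = b (s + d)) → n ≤ T ((k + 1) * (k + k + 2) + (k + 1)) := by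
  have key : ∀ i d e i₀, i ≤ n → d < k + k + 1 → e ≤ k → i₀ ≤ i →
      i₀ ≤ candidate n T (e * (k + k + 2) + (d + 1)) →
      (∀ s, i₀ ≤ s → s < i → a s = b (s + d)) → i ≤ T ((e + 1) * (k + k + 2) + (d + 1)) := by
    intro i d e i₀ hi hd he h₀ hc hs
    have hadv := h.advances he hd
    rcases Nat.lt_or_ge i (candidate n T (e * (k + k + 2) + (d + 1))) with hlt | hge
    · exact hlt.le.trans hadv.le
    · exact hadv.furthest i hi hge fun y z hy hyz hz =>
        hP d hd y z hyz (hz.trans hi) fun s h1 h2 => hs s (by omega) (by omega)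
  induction hA with
  | nil m =>
    intro i d e i₀ hu hv hi hid h1 h2 h3 h4 h5 h6
    have hu' := congrArg List.length hu
    have hv' := congrArg List.length hv
    rw [segment_length, List.length_nil] at hu' hv'
    have hdk : d = k := by omega
    have hin : i = n := by omega
    subst hdk hin
    -- Edits left over do no harm: further rows never fall back, as the candidate dominates the
    -- entry one row before, which is at most the length.
    have hmono : ∀ e' ≥ e, e' ≤ d → i ≤ T ((e' + 1) * (d + d + 2) + (d + 1)) := by
      intro e' he'
      induction e', he' using Nat.le_induction with
      | base => exact fun hd => key i d e i₀ le_rfl (by omega) hd h4 h5 h6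
      | succ e' he' ih =>
        intro hd
        have hadv := h.advances hd (show d < d + d + 1 by omega)
        refine le_trans ?_ hadv.le
        have := ih (by omega)
        unfold candidate
        omega
    exact hmono d (by omega) le_rfl
  | cons c _ ih =>
    intro i d e i₀ hu hv hi hid h1 h2 h3 h4 h5 h6
    have hi' : i < n := by
      by_contra hcon
      rw [show i = n by omega, segment_self] at hu
      cases hu
    have hid' : i + d < n + k := by
      by_contra hcon
      rw [show i + d = n + k by omega, segment_self] at hv
      cases hv
    rw [segment_cons a hi'] at hu
    rw [segment_cons b hid'] at hv
    injection hu with hu1 hu2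
    injection hv with hv1 hv2
    refine ih (i + 1) d e i₀ hu2 (by rw [hv2, Nat.add_right_comm]) hi' (by omega) h1 h2 h3
      (by omega) h5 fun s hs hs' => ?_
    rcases Nat.lt_or_ge s i with hlt | hge
    · exact h6 s hs hlt
    · rw [show s = i by omega, ← hu1, hv1]
  | sub c c' _ ih =>
    intro i d e i₀ hu hv hi hid h1 h2 h3 h4 h5 h6
    have hi' : i < n := by
      by_contra hcon
      rw [show i = n by omega, segment_self] at hu
      cases hu
    have hid' : i + d < n + k := by
      by_contra hcon
      rw [show i + d = n + k by omega, segment_self] at hv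
      cases hv
    rw [segment_cons a hi'] at hu
    rw [segment_cons b hid'] at hv
    injection hu with hu1 hu2
    injection hv with hv1 hv2
    have hT := key i d e i₀ hi (by omega) (by omega) h4 h5 h6
    refine ih (i + 1) d (e + 1) (i + 1) hu2 (by rw [hv2, Nat.add_right_comm]) hi' (by omega)
      (by omega) (by omega) (by omega) le_rfl ?_ fun s hs hs' => by omega
    unfold candidate
    omega
  | del c _ ih =>
    intro i d e i₀ hu hv hi hid h1 h2 h3 h4 h5 h6
    have hi' : i < n := by
      by_contra hcon
      rw [show i = n by omega, segment_self] at hu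
      cases hu
    rw [segment_cons a hi'] at hu
    injection hu with hu1 hu2
    have hT := key i d e i₀ hi (by omega) (by omega) h4 h5 h6
    -- Diagonal `0` is excluded: being there takes `k` edits, and one is still to come.
    obtain ⟨d, rfl⟩ : ∃ d', d = d' + 1 := ⟨d - 1, by omega⟩
    refine ih (i + 1) d (e + 1) (i + 1) hu2 (by rw [hv, Nat.add_right_comm, Nat.add_assoc]) hi'
      (by omega) (by omega) (by omega) (by omega) le_rfl ?_ fun s hs hs' => by omega
    unfold candidate
    rw [← Nat.add_assoc] at hT
    omega
  | ins c _ ih =>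
    intro i d e i₀ hu hv hi hid h1 h2 h3 h4 h5 h6
    have hid' : i + d < n + k := by
      by_contra hcon
      rw [show i + d = n + k by omega, segment_self] at hv
      cases hv
    rw [segment_cons b hid'] at hv
    injection hv with hv1 hv2
    have hT := key i d e i₀ hi (by omega) (by omega) h4 h5 h6
    refine ih i (d + 1) (e + 1) i hu (by rw [hv2, Nat.add_assoc]) hi
      (by omega) (by omega) (by omega) (by omega) le_rfl ?_ fun s hs hs' => by omega
    unfold candidate
    rw [show (e + 1) * (k + k + 2) + (d + 1 + 1) - 1 = (e + 1) * (k + k + 2) + (d + 1) by omega]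
    omega

/-- If the edit distance is small, the table reaches the end of the strings. -/
theorem IsTable.complete (h : IsTable P n k T)
    (hP : ∀ d < k + k + 1, ∀ x z, x ≤ z → z ≤ n → (∀ s, x ≤ s → s < z → a s = b (s + d)) → P d x z)
    (hA : editDist (segment a 0 n) (segment b k (n + k)) ≤ k) :
    T ((k + 1) * (k + k + 2) + (k + 1)) = n := by
  refine le_antisymm (h.advances le_rfl (by omega)).le_length ?_
  exact h.le_of_align hP (Align.of_editDist_le hA) 0 k 0 0 rfl (by rw [Nat.zero_add]) (by omega)
    (by omega) (by omega) (by omega) (by omega) le_rfl (Nat.zero_le _) fun s hs hs' => by omega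

end Table

end GapEdit

namespace GapEdit

/-! ### Sums of random samples -/

open Finset in
/-- A sum of independent random variables, each of which vanishes with probability at least one
half, is not much more concentrated than with probability one half. -/
theorem card_sum_eq_le {V Γ : Type*} [Fintype V] [AddCommGroup Γ] [DecidableEq Γ] {K : ℕ}
    (hK : 0 < K) (hV : Fintype.card V = 2 * K) {m : ℕ} (g : Fin m → V → Γ)
    (hg : ∀ b, #{y | g b y ≠ 0} ≤ K) (z : Γ) :
    (#{v : Fin m → V | ∑ b, g b (v b) = z} : ℝ) ≤
      (2 * K : ℝ) ^ m * ((1 + ∏ b, (1 - (#{y | g b y ≠ 0} : ℝ) / K)) / 2) := by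
  have hK' : (0 : ℝ) < K := by exact_mod_cast hK
  induction m generalizing z with
  | zero =>
    simp only [univ_eq_empty, sum_empty, prod_empty, pow_zero]
    norm_num
    exact (card_le_univ _).trans (by simp)
  | succ m ih =>
    set f : Γ → ℕ := fun z => #{v : Fin m → V | ∑ b, g b.succ (v b) = z} with hf
    set c := #{y | g 0 y ≠ 0} with hc
    set p := ∏ b : Fin m, (1 - (#{y | g b.succ y ≠ 0} : ℝ) / K) with hp
    have hfz : (f z : ℝ) ≤ (2 * K : ℝ) ^ m * ((1 + p) / 2) :=
      ih (fun b => g b.succ) (fun b => hg b.succ) z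
    -- Different values of the sum are disjoint events, so the count for `z'` is bounded by the
    -- complement of the count for `z`.
    have hpair : ∀ z', z' ≠ z → (f z' : ℝ) ≤ (2 * K : ℝ) ^ m - f z := by
      intro z' hz'
      have h1 : f z' + f z ≤ (2 * K) ^ m := by
        classical
        rw [hf]
        simp only
        rw [← card_union_of_disjoint]
        · refine (card_le_univ _).trans ?_
          simp [hV]
        · rw [disjoint_filter]
          rintro v - h1 h2
          exact hz' (h1.symm.trans h2)
      have h2 : ((f z' + f z : ℕ) : ℝ) ≤ (2 * K : ℝ) ^ m := by exact_mod_cast h1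
      push_cast at h2
      linarith
    have hcount : #{v : Fin (m + 1) → V | ∑ b, g b (v b) = z} = ∑ y, f (z - g 0 y) := by
      rw [hf]
      simp only [card_filter]
      rw [← (Fin.consEquiv fun _ => V).sum_comp, Fintype.sum_prod_type]
      refine sum_congr rfl fun y _ => sum_congr rfl fun v _ => ?_
      simp [Fin.sum_univ_succ, Fin.consEquiv, eq_sub_iff_add_eq']
    have hsum : (∑ y, (f (z - g 0 y) : ℝ)) ≤
        ∑ y, if g 0 y ≠ 0 then (2 * K : ℝ) ^ m - f z else (f z : ℝ) := by
      refine sum_le_sum fun y _ => ?_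
      split_ifs with hy
      · exact hpair _ (by simpa using hy)
      · rw [not_not.1 hy, sub_zero]
    have hcard : #{y | ¬ g 0 y ≠ 0} = 2 * K - c := by
      have := card_filter_add_card_filter_not (s := (univ : Finset V)) (fun y => g 0 y ≠ 0)
      rw [card_univ, hV] at this
      omega
    rw [sum_ite, sum_const, sum_const, hcard, nsmul_eq_mul, nsmul_eq_mul, ← hc,
      Nat.cast_sub (by have := hg 0; omega)] at hsum
    have hcK : (c : ℝ) ≤ K := by exact_mod_cast hg 0
    rw [hcount, Fin.prod_univ_succ, ← hp, ← hc]
    push_cast at hsum ⊢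
    refine hsum.trans ?_
    have e1 : (2 * K : ℝ) ^ (m + 1) * ((1 + (1 - (c : ℝ) / K) * p) / 2) =
        (2 * K : ℝ) ^ m * (K + (K - c) * p) := by
      field_simp
      ring
    rw [e1]
    -- As `c ≤ K`, the bound `c * (2 * K) ^ m + (2 * K - 2 * c) * f z` increases with `f z`, and the
    -- induction hypothesis can be inserted.
    nlinarith [mul_le_mul_of_nonneg_left hfz (show (0 : ℝ) ≤ 2 * K - 2 * c by linarith)]

-- By `1 - t ≤ exp (-t)`, the product in `card_sum_eq_le` is at most `exp (-1) ≤ 1 / 2`.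
open Finset in
theorem card_sum_eq_zero_le {V Γ : Type*} [Fintype V] [AddCommGroup Γ] [DecidableEq Γ] {K : ℕ}
    (hK : 0 < K) (hV : Fintype.card V = 2 * K) {m : ℕ} (g : Fin m → V → Γ)
    (hg : ∀ b, #{y | g b y ≠ 0} ≤ K) (hsum : K ≤ ∑ b, #{y | g b y ≠ 0}) :
    (#{v : Fin m → V | ∑ b, g b (v b) = 0} : ℝ) ≤ (2 * K : ℝ) ^ m * (3 / 4) := by
  have hK' : (0 : ℝ) < K := by exact_mod_cast hK
  refine (card_sum_eq_le hK hV g hg 0).trans (mul_le_mul_of_nonneg_left ?_ (by positivity))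
  have h1 : ∏ b, (1 - (#{y | g b y ≠ 0} : ℝ) / K) ≤
      ∏ b, Real.exp (-((#{y | g b y ≠ 0} : ℝ) / K)) := by
    refine prod_le_prod (fun b _ => ?_) (fun b _ => ?_)
    · rw [sub_nonneg, div_le_one hK']
      exact_mod_cast hg b
    · have := Real.add_one_le_exp (-((#{y | g b y ≠ 0} : ℝ) / K))
      linarith
  have h2 : (1 : ℝ) ≤ ∑ b, (#{y | g b y ≠ 0} : ℝ) / K := by
    rw [← sum_div, le_div_iff₀ hK', one_mul]
    exact_mod_cast hsum
  rw [← Real.exp_sum, sum_neg_distrib] at h1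
  have h3 : Real.exp (-∑ b, (#{y | g b y ≠ 0} : ℝ) / K) ≤ Real.exp (-1) :=
    Real.exp_le_exp.2 (by linarith)
  have h4 : Real.exp (-1) ≤ 1 / 2 := by
    rw [Real.exp_neg, one_div]
    exact inv_anti₀ (by norm_num) (by linarith [Real.exp_one_gt_d9])
  linarith

/-! ### Random bits -/

instance : MeasureTheory.IsProbabilityMeasure coinMeasure := by
  unfold coinMeasure; infer_instance

/-- Extend a finite sequence of bits. -/
def extendBits {T : ℕ} (v : Fin T → Bool) (i : ℕ) : Bool := if h : i < T then v ⟨i, h⟩ else false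

theorem coinMeasure_cylinder {T : ℕ} (v : Fin T → Bool) :
    coinMeasure.real {ω | ∀ i : Fin T, ω i = v i} = (1 / 2) ^ T := by
  have h1 : {ω : ℕ → Bool | ∀ i : Fin T, ω i = v i} =
      Set.pi (Finset.range T) fun i => {extendBits v i} := by
    ext ω
    simp only [Set.mem_ofPred_eq, Set.mem_pi, Finset.coe_range, Set.mem_Iio, Set.mem_singleton_iff]
    refine ⟨fun h i hi => ?_, fun h i => ?_⟩
    · simp [extendBits, hi, h ⟨i, hi⟩]
    · simpa [extendBits] using h i i.2
  rw [h1, MeasureTheory.measureReal_def, coinMeasure,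
    MeasureTheory.Measure.infinitePi_pi _ (fun _ _ => MeasurableSet.singleton _)]
  simp

open Finset in
open Classical in
/-- The probability of an event that is determined by the first `T` bits. -/
theorem coinMeasure_le {T : ℕ} {p : (ℕ → Bool) → Prop}
    (hp : ∀ ω ω', (∀ i < T, ω i = ω' i) → p ω → p ω') :
    coinMeasure.real {ω | p ω} ≤ (#{v : Fin T → Bool | p (extendBits v)} : ℝ) * (1 / 2) ^ T := by
  -- Covering by cylinders bounds the outer measure, so no measurability of the event is needed.
  have hsub : {ω | p ω} ⊆ ⋃ v ∈ ({v : Fin T → Bool | p (extendBits v)} : Finset (Fin T → Bool)),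
      {ω : ℕ → Bool | ∀ i : Fin T, ω i = v i} := by
    intro ω hω
    simp only [Set.mem_iUnion]
    refine ⟨fun i => ω i, ?_, fun i => rfl⟩
    simp only [mem_filter, mem_univ, true_and]
    exact hp _ _ (fun i hi => by simp [extendBits, hi]) hω
  refine (MeasureTheory.measureReal_mono hsub (MeasureTheory.measure_ne_top _ _)).trans
    ((MeasureTheory.measureReal_biUnion_finset_le _ _).trans ?_)
  simp only [coinMeasure_cylinder]
  rw [sum_const, nsmul_eq_mul]

theorem ofDigits_inj {f g : ℕ → Bool} {m : ℕ} (h : ofDigits f m = ofDigits g m) :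
    ∀ t < m, f t = g t := by
  induction m with
  | zero => simp
  | succ m ih =>
    have h1 := ofDigits_lt f m
    have h2 := ofDigits_lt g m
    rw [ofDigits, ofDigits, Finset.sum_range_succ, Finset.sum_range_succ, ← ofDigits,
      ← ofDigits] at h
    have h3 : f m = g m := by
      cases hf : f m <;> cases hg : g m <;> simp [hf, hg] at h ⊢ <;> omega
    rw [h3] at h
    intro t ht
    rcases Nat.lt_succ_iff_lt_or_eq.1 ht with h' | rfl
    · exact ih (by omega) t h'
    · exact h3

theorem ofDigits_congr {f g : ℕ → Bool} {m : ℕ} (h : ∀ t < m, f t = g t) :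
    ofDigits f m = ofDigits g m :=
  Finset.sum_congr rfl fun t ht => by rw [h t (Finset.mem_range.1 ht)]

open Finset in
/-- The probability that the sums of the samples vanish in all repetitions. -/
theorem coinMeasure_samples_le {Γ : Type*} [AddCommGroup Γ] [DecidableEq Γ] (a L nb : ℕ)
    (g : ℕ → ℕ → Γ) (hg : ∀ b < nb, #{y : Fin (2 ^ (a + 1)) | g b y ≠ 0} ≤ 2 ^ a)
    (hsum : 2 ^ a ≤ ∑ b : Fin nb, #{y : Fin (2 ^ (a + 1)) | g b y ≠ 0}) :
    coinMeasure.real {ω | ∀ j < L, ∑ b ∈ range nb, g b (sample ω (a + 1) (j * nb + b)) = 0} ≤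
      (3 / 4) ^ L := by
  classical
  set T := L * nb * (a + 1) with hT
  have hidx : ∀ {j b t}, j < L → b < nb → t < a + 1 → (j * nb + b) * (a + 1) + t < T :=
    fun hj hb ht => index_lt (index_lt hj hb) ht
  refine (coinMeasure_le (T := T) ?_).trans ?_
  · intro ω ω' h hω j hj
    rw [← hω j hj]
    refine sum_congr rfl fun b hb => ?_
    rw [sample, sample, ofDigits_congr fun t ht => (h _ (hidx hj (mem_range.1 hb) ht)).symm]
  · set S : Finset (Fin nb → Fin (2 ^ (a + 1))) := {v | ∑ b : Fin nb, g b (v b) = 0} with hS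
    have hScard : (#S : ℝ) ≤ (2 ^ (a + 1) : ℝ) ^ nb * (3 / 4) := by
      have := card_sum_eq_zero_le (K := 2 ^ a) (by positivity) (by simp [pow_succ, mul_comm])
        (fun (b : Fin nb) (y : Fin (2 ^ (a + 1))) => g b y) (fun b => hg b b.2) hsum
      rw [hS]
      convert this using 3
      push_cast
      ring
    -- Regroups the bits into `L` tuples of `nb` samples. Injectivity is enough for an upper bound
    -- on the count.
    let φ : (Fin T → Bool) → Fin L → Fin nb → Fin (2 ^ (a + 1)) := fun v j b =>
      ⟨sample (extendBits v) (a + 1) (j * nb + b), ofDigits_lt _ _⟩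
    have hφ : Function.Injective φ := by
      intro v v' h
      funext i
      have hi : (i : ℕ) < L * nb * (a + 1) := i.2
      have hq : (i : ℕ) / (a + 1) < L * nb := Nat.div_lt_of_lt_mul (by rwa [mul_comm])
      have hnb : 0 < nb := Nat.pos_of_ne_zero fun h => by simp [h] at hq
      have hj : (i : ℕ) / (a + 1) / nb < L := Nat.div_lt_of_lt_mul (by rwa [mul_comm])
      have hb : (i : ℕ) / (a + 1) % nb < nb := Nat.mod_lt _ hnb
      have h1 := congrArg Fin.val (congrFun (congrFun h ⟨_, hj⟩) ⟨_, hb⟩)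
      have h2 := ofDigits_inj h1 (i % (a + 1)) (Nat.mod_lt _ (Nat.succ_pos a))
      simp only [Nat.div_add_mod', extendBits] at h2
      simpa using h2
    have hcard : #{v : Fin T → Bool | ∀ j < L,
        ∑ b ∈ range nb, g b (sample (extendBits v) (a + 1) (j * nb + b)) = 0} ≤ #S ^ L := by
      refine (card_le_card_of_injOn φ (t := Fintype.piFinset fun _ : Fin L => S) ?_
        hφ.injOn).trans (by simp)
      intro v hv
      simp only [coe_filter, mem_univ, true_and, Set.mem_ofPred_eq] at hv
      simp only [Fintype.coe_piFinset, Set.mem_pi, Set.mem_univ, true_implies, hS, coe_filter,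
        mem_univ, true_and, Set.mem_ofPred_eq]
      intro j
      have := hv j j.2
      rw [sum_range] at this
      exact this
    have hcard' : (#{v : Fin T → Bool | ∀ j < L,
        ∑ b ∈ range nb, g b (sample (extendBits v) (a + 1) (j * nb + b)) = 0} : ℝ) ≤
        (#S : ℝ) ^ L := by exact_mod_cast hcard
    have hpow : ((2 ^ (a + 1) : ℝ) ^ nb * (3 / 4)) ^ L * (1 / 2) ^ T = (3 / 4) ^ L := by
      rw [mul_pow, ← pow_mul, ← pow_mul, show (a + 1) * (nb * L) = T by rw [hT]; ring,
        mul_right_comm, ← mul_pow]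
      norm_num
    calc _ ≤ (#S : ℝ) ^ L * (1 / 2) ^ T := by
            refine mul_le_mul_of_nonneg_right (le_trans (le_of_eq ?_) hcard') (by positivity)
            congr!
      _ ≤ ((2 ^ (a + 1) : ℝ) ^ nb * (3 / 4)) ^ L * (1 / 2) ^ T :=
          mul_le_mul_of_nonneg_right (pow_le_pow_left₀ (by positivity) hScard _) (by positivity)
      _ = _ := hpow

end GapEdit

namespace GapEdit

/-! ### The tests made by the query program -/

open Finset

/-- Samples of successive blocks lie at increasing positions, so those before `i` come from an
initial range of blocks. Blocks without a sample contribute zero, however they are counted. -/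
theorem sum_cut {Γ : Type*} [AddCommMonoid Γ] {K nb i : ℕ} {u : ℕ → ℕ} {f : ℕ → Γ}
    (hi : i / K < nb) (hK : 0 < K) (hf : ∀ β, K ≤ u β → f β = 0) :
    ∑ β ∈ range (cut K u i), f β = ∑ β ∈ range nb, if β * K + u β < i then f β else 0 := by
  have hc : cut K u i ≤ nb := by
    unfold cut
    split_ifs <;> omega
  have h1 : (range nb).filter (fun β => β < cut K u i) = range (cut K u i) := by
    ext β
    simp only [mem_filter, mem_range]
    omega
  rw [← h1, sum_filter]
  refine sum_congr rfl fun β _ => ?_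
  by_cases hu : K ≤ u β
  · simp [hf β hu]
  · refine if_congr ?_ rfl rfl
    have hdiv := Nat.div_add_mod' i K
    have hmod := Nat.mod_lt i hK
    unfold cut
    rcases lt_trichotomy β (i / K) with h | rfl | h
    · have : (β + 1) * K ≤ i / K * K := Nat.mul_le_mul_right _ h
      rw [Nat.add_one_mul] at this
      exact iff_of_true (by omega) (by omega)
    · split_ifs <;> omega
    · have : (i / K + 1) * K ≤ β * K := Nat.mul_le_mul_right _ h
      rw [Nat.add_one_mul] at this
      refine iff_of_false ?_ (by omega)
      split_ifs <;> omega

theorem cast_prefix {M N r nb c : ℕ} {h t : ℕ → ℕ}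
    (hh : ∀ q ≤ N, h q = (∑ p ∈ range q, t p) % M) (hN : r * nb + c ≤ N) :
    (h (r * nb + c) : ZMod M) =
      ∑ p ∈ range (r * nb), (t p : ZMod M) + ∑ β ∈ range c, (t (r * nb + β) : ZMod M) := by
  rw [hh _ hN, ZMod.natCast_mod, Finset.sum_range_add]
  push_cast
  rfl

/-- The contribution of block `β` with sample `y` to the difference of the sums of the samples
between the positions `x` and `z`. -/
def sampleDiff (w K : ℕ) (a b : ℕ → ℕ) (d x z β y : ℕ) : ZMod (2 ^ w) :=
  if y < K ∧ x ≤ β * K + y ∧ β * K + y < z then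
    (a (β * K + y) : ZMod (2 ^ w)) - (b (β * K + y + d) : ZMod (2 ^ w)) else 0

/-- All prefix sums of `A` share the part before row `j`, and all those of `B` the part before row
`j * D + d`. These parts cancel, which leaves the samples between `x` and `z`. -/
theorem agree_iff {w K L nb D j d x z : ℕ} {a b u u' hA hB : ℕ → ℕ} (hK : 0 < K)
    (hu : ∀ q < L * nb, u' q = u q)
    (hhA : ∀ q ≤ L * nb, hA q = (∑ p ∈ range q, termA a K nb u p) % 2 ^ w)
    (hhB : ∀ q ≤ L * D * nb, hB q = (∑ p ∈ range q, termB b K D nb u p) % 2 ^ w)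
    (hj : j < L) (hd : d < D) (hxz : x ≤ z) (hz : z / K < nb) :
    Agree w K nb D u' hA hB j d x z ↔
      ∑ β ∈ range nb, sampleDiff w K a b d x z β (u (j * nb + β)) = 0 := by
  have hx : x / K < nb := (Nat.div_le_div_right hxz).trans_lt hz
  set uj : ℕ → ℕ := fun β => u (j * nb + β) with huj
  have hcut : ∀ i, i / K < nb → cut K (fun β => u' (j * nb + β)) i = cut K uj i := by
    intro i hi
    unfold cut
    simp only [huj, hu _ (index_lt hj hi)]
  have hcle : ∀ i, i / K < nb → cut K uj i ≤ nb := by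
    intro i hi
    unfold cut
    split_ifs <;> omega
  have hjL : j * nb + nb ≤ L * nb := by nlinarith
  have hr : (j * D + d) * nb + nb ≤ L * D * nb := by nlinarith [index_lt hj hd]
  have hmod : ∀ r β, β < nb → (r * nb + β) % nb = β := fun r β hβ => by
    rw [Nat.add_comm, Nat.add_mul_mod_self_right, Nat.mod_eq_of_lt hβ]
  have hdiv : ∀ r β, β < nb → (r * nb + β) / nb = r := fun r β hβ => by
    rw [Nat.add_comm, Nat.add_mul_div_right _ _ (by omega), Nat.div_eq_of_lt hβ, Nat.zero_add]
  have hD : 0 < D := by omega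
  have hdivD : (j * D + d) / D = j := by
    rw [Nat.add_comm, Nat.add_mul_div_right _ _ hD, Nat.div_eq_of_lt hd, Nat.zero_add]
  have hmodD : (j * D + d) % D = d := by
    rw [Nat.add_comm, Nat.add_mul_mod_self_right, Nat.mod_eq_of_lt hd]
  let tA : ℕ → ZMod (2 ^ w) := fun β => ((if uj β < K then a (β * K + uj β) else 0 : ℕ) : ZMod _)
  let tB : ℕ → ZMod (2 ^ w) := fun β =>
    ((if uj β < K then b (β * K + uj β + d) else 0 : ℕ) : ZMod _)
  have hsA : ∀ i, i / K < nb → (hA (j * nb + cut K uj i) : ZMod (2 ^ w)) =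
      ∑ p ∈ range (j * nb), (termA a K nb u p : ZMod (2 ^ w)) +
        ∑ β ∈ range nb, if β * K + uj β < i then tA β else 0 := by
    intro i hi
    have := hcle i hi
    rw [cast_prefix hhA (by omega), ← sum_cut hi hK (fun β hβ => by simp [tA, not_lt.2 hβ])]
    congr 1
    refine sum_congr rfl fun β hβ => ?_
    have hβ' : β < nb := (mem_range.1 hβ).trans_le this
    simp only [termA, hmod _ _ hβ', tA, huj]
  have hsB : ∀ i, i / K < nb → (hB ((j * D + d) * nb + cut K uj i) : ZMod (2 ^ w)) =
      ∑ p ∈ range ((j * D + d) * nb), (termB b K D nb u p : ZMod (2 ^ w)) +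
        ∑ β ∈ range nb, if β * K + uj β < i then tB β else 0 := by
    intro i hi
    have := hcle i hi
    rw [cast_prefix hhB (by omega), ← sum_cut hi hK (fun β hβ => by simp [tB, not_lt.2 hβ])]
    congr 1
    refine sum_congr rfl fun β hβ => ?_
    have hβ' : β < nb := (mem_range.1 hβ).trans_le this
    simp only [termB, hmod _ _ hβ', hdiv _ _ hβ', hdivD, hmodD, tB, huj]
  have hsum : ∑ β ∈ range nb, sampleDiff w K a b d x z β (u (j * nb + β)) =
      (∑ β ∈ range nb, if β * K + uj β < z then tA β else 0) -
      (∑ β ∈ range nb, if β * K + uj β < x then tA β else 0) -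
      ((∑ β ∈ range nb, if β * K + uj β < z then tB β else 0) -
      (∑ β ∈ range nb, if β * K + uj β < x then tB β else 0)) := by
    rw [← sum_sub_distrib, ← sum_sub_distrib, ← sum_sub_distrib]
    refine sum_congr rfl fun β _ => ?_
    change sampleDiff w K a b d x z β (uj β) = _
    simp only [sampleDiff, tA, tB]
    by_cases h1 : uj β < K
    · by_cases h2 : β * K + uj β < x
      · simp [h1, h2, h2.trans_le hxz, not_le.2 h2]
      · by_cases h3 : β * K + uj β < z
        · simp [h1, h2, h3, not_lt.1 h2]
        · simp [h1, h2, h3]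
    · simp [h1]
  unfold Agree
  rw [hcut x hx, hcut z hz, ← ZMod.natCast_eq_natCast_iff, hsum]
  push_cast
  rw [hsA x hx, hsA z hz, hsB x hx, hsB z hz]
  constructor
  · intro h
    linear_combination h
  · intro h
    linear_combination h

theorem agreeAll_of_match {w K L nb D d x z : ℕ} {a b u u' hA hB : ℕ → ℕ} (hK : 0 < K)
    (hu : ∀ q < L * nb, u' q = u q)
    (hhA : ∀ q ≤ L * nb, hA q = (∑ p ∈ range q, termA a K nb u p) % 2 ^ w)
    (hhB : ∀ q ≤ L * D * nb, hB q = (∑ p ∈ range q, termB b K D nb u p) % 2 ^ w)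
    (hd : d < D) (hxz : x ≤ z) (hz : z / K < nb)
    (h : ∀ s, x ≤ s → s < z → a s = b (s + d)) :
    AgreeAll w K L nb D u' hA hB d x z := by
  intro j hj
  rw [agree_iff hK hu hhA hhB hj hd hxz hz]
  refine sum_eq_zero fun β _ => ?_
  unfold sampleDiff
  split_ifs with h1
  · rw [h _ h1.2.1 h1.2.2, sub_self]
  · rfl

/-- It is unlikely that a segment with many mismatches passes the tests. -/
theorem coinMeasure_sampleDiff_le {w a' L nb d x z : ℕ} {a b : ℕ → ℕ} (ha : ∀ i, a i < 2 ^ w)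
    (hb : ∀ i, b i < 2 ^ w) (hz : z / 2 ^ a' < nb) (h : 2 ^ a' ≤ mismatches a b d x z) :
    coinMeasure.real {ω | ∀ j < L, ∑ β ∈ range nb,
      sampleDiff w (2 ^ a') a b d x z β (sample ω (a' + 1) (j * nb + β)) = 0} ≤ (3 / 4) ^ L := by
  have hK : 0 < 2 ^ a' := by positivity
  refine coinMeasure_samples_le a' L nb _ (fun β _ => ?_) (h.trans ?_)
  · refine (card_le_card_of_injOn (t := range (2 ^ a')) Fin.val (fun y hy => ?_)
      Fin.val_injective.injOn).trans (by simp)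
    rw [mem_coe, mem_filter] at hy
    simp only [coe_range, Set.mem_Iio]
    by_contra hcon
    exact hy.2 (if_neg fun h => hcon h.1)
  -- A mismatch at `s` makes the offset `s % 2 ^ a'` of block `s / 2 ^ a'` contribute a nonzero
  -- value, so the blocks have together at least as many such offsets as there are mismatches.
  · unfold mismatches
    rw [card_eq_sum_card_fiberwise (f := fun s => s / 2 ^ a') (t := range nb), sum_range]
    · refine sum_le_sum fun β _ => ?_
      refine card_le_card_of_injOn
        (fun s => ⟨s % 2 ^ a', (Nat.mod_lt s hK).trans (by rw [pow_succ]; omega)⟩) ?_ ?_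
      · intro s hs
        simp only [coe_filter, mem_filter, mem_Ico, Set.mem_ofPred_eq] at hs
        obtain ⟨⟨⟨h1, h2⟩, h3⟩, h4⟩ := hs
        have h5 : (β : ℕ) * 2 ^ a' + s % 2 ^ a' = s := by rw [← h4]; exact Nat.div_add_mod' _ _
        rw [mem_coe, mem_filter]
        refine ⟨mem_univ _, ?_⟩
        simp only [sampleDiff, h5]
        rw [if_pos ⟨Nat.mod_lt s hK, h1, h2⟩, sub_ne_zero]
        intro h6
        rw [ZMod.natCast_eq_natCast_iff] at h6
        -- Code words are smaller than the modulus, so different characters remain different in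
        -- `ZMod (2 ^ w)`.
        exact h3 (Nat.ModEq.eq_of_lt_of_lt h6 (ha _) (hb _))
      · intro s hs s' hs' hss
        simp only [coe_filter, Set.mem_ofPred_eq] at hs hs'
        have h6 : s % 2 ^ a' = s' % 2 ^ a' := congrArg Fin.val hss
        rw [← Nat.div_add_mod' s (2 ^ a'), ← Nat.div_add_mod' s' (2 ^ a'), hs.2, hs'.2, h6]
    · intro s hs
      simp only [coe_filter, mem_Ico, Set.mem_ofPred_eq] at hs
      simp only [coe_range, Set.mem_Iio]
      exact (Nat.div_le_div_right hs.1.2.le).trans_lt hz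

end GapEdit

namespace GapEdit

/-! ### The two programs together -/

/-- The number of blocks. -/
def numBlocks (n k : ℕ) : ℕ := n / 2 ^ Nat.log 2 k + 1

/-- The number of repetitions. -/
def numRepeats (n : ℕ) : ℕ := 16 * Nat.clog 2 (n + 2)

theorem clog_bounds (n : ℕ) :
    n + 2 ≤ 2 ^ Nat.clog 2 (n + 2) ∧ 2 ^ Nat.clog 2 (n + 2) < 2 * (n + 2) ∧
      1 ≤ Nat.clog 2 (n + 2) ∧ Nat.clog 2 (n + 2) < n + 2 := by
  set l := Nat.clog 2 (n + 2) with hl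
  have h0 : 1 ≤ l := Nat.clog_pos (by omega) (by omega)
  have h1 : n + 2 ≤ 2 ^ l := Nat.le_pow_clog (by omega) _
  have h2 : 2 ^ (l - 1) < n + 2 := Nat.pow_lt_of_lt_clog (by omega)
  have h3 : l - 1 < 2 ^ (l - 1) := Nat.lt_two_pow_self
  have h4 : 2 ^ l = 2 ^ (l - 1) * 2 := by rw [← pow_succ]; congr 1
  refine ⟨h1, by omega, h0, by omega⟩

theorem block_bounds {k : ℕ} (hk : 1 ≤ k) :
    2 ^ Nat.log 2 k ≤ k ∧ k < 2 * 2 ^ Nat.log 2 k := by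
  refine ⟨Nat.pow_log_le_self 2 (by omega), ?_⟩
  have := Nat.lt_pow_succ_log_self (b := 2) (by omega) k
  rwa [pow_succ, mul_comm] at this

/-- All quantities that occur fit into a word. -/
theorem word_bounds {w n k : ℕ} (hn : 1 ≤ n) (hk : 1 ≤ k) (hkn : k ≤ n)
    (hw : (n + 2) ^ 12 ≤ 2 ^ w) :
    64 * (n + 2) < 2 ^ w ∧ 2 ^ (Nat.log 2 k + 2) ≤ 2 ^ w ∧
      numRepeats n * (k + k + 1) * numBlocks n k + numBlocks n k < 2 ^ w ∧
      numRepeats n * numBlocks n k + numBlocks n k < 2 ^ w ∧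
      n + 2 ^ Nat.clog 2 (n + 2) < 2 ^ w ∧ (k + 2) * (k + k + 1 + 1) + 1 < 2 ^ w ∧
      numBlocks n k * 2 ^ Nat.log 2 k + 2 * 2 ^ Nat.log 2 k < 2 ^ w := by
  obtain ⟨-, l2, -, l4⟩ := clog_bounds n
  obtain ⟨k1, k2⟩ := block_bounds hk
  set X := n + 2 with hX
  have hX3 : 3 ≤ X := by omega
  have hM : 64 * X ^ 3 < 2 ^ w := by
    refine lt_of_lt_of_le ?_ hw
    -- Nine of the twelve factors `X ≥ 3` absorb the constant 64.
    have h9 : 3 ^ 9 ≤ X ^ 9 := Nat.pow_le_pow_left hX3 9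
    have : 0 < X ^ 3 := by positivity
    calc 64 * X ^ 3 < 3 ^ 9 * X ^ 3 := by nlinarith
      _ ≤ X ^ 9 * X ^ 3 := Nat.mul_le_mul_right _ h9
      _ = X ^ 12 := by ring
  have hX1 : X * 9 ≤ X ^ 3 := by nlinarith [Nat.mul_le_mul hX3 hX3]
  have hX2 : X ^ 2 ≤ X ^ 3 := Nat.pow_le_pow_right (by omega) (by omega)
  have hnb : numBlocks n k ≤ X := by
    have := Nat.div_le_self n (2 ^ Nat.log 2 k)
    unfold numBlocks
    omega
  have hL : numRepeats n ≤ 16 * X := by rw [numRepeats, ← hX]; omega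
  have hL1 : numRepeats n * numBlocks n k ≤ 16 * X ^ 2 :=
    (Nat.mul_le_mul hL hnb).trans (by ring_nf; rfl)
  have hL2 : numRepeats n * (k + k + 1) * numBlocks n k ≤ 32 * X ^ 3 :=
    (Nat.mul_le_mul (Nat.mul_le_mul hL (show k + k + 1 ≤ 2 * X by omega)) hnb).trans
      (by ring_nf; rfl)
  have hD : (k + 2) * (k + k + 1 + 1) ≤ 2 * X ^ 2 :=
    (Nat.mul_le_mul (show k + 2 ≤ X by omega) (show k + k + 1 + 1 ≤ 2 * X by omega)).trans
      (by ring_nf; rfl)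
  have hB : numBlocks n k * 2 ^ Nat.log 2 k ≤ X ^ 2 :=
    (Nat.mul_le_mul hnb (k1.trans (show k ≤ X by omega))).trans (by ring_nf; rfl)
  refine ⟨by omega, ?_, by omega, by omega, by omega, by omega, by omega⟩
  rw [pow_add]
  omega

/-- What the query program finds in memory. -/
structure Prepared (w n k : ℕ) (inp : ℕ → ℕ) (ω : ℕ → Bool) (s : Store) : Prop where
  samples : ∀ q < numRepeats n * numBlocks n k, s.arr 0 q = sample ω (Nat.log 2 k + 1) q
  hash : ∀ q ≤ numRepeats n * (k + k + 1) * numBlocks n k, s.arr 1 q =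
    (∑ p ∈ Finset.range q, termB (shifted w k inp) (2 ^ Nat.log 2 k) (k + k + 1) (numBlocks n k)
      (sample ω (Nat.log 2 k + 1)) p) % 2 ^ w
  zero : ∀ b, b ≠ 0 → b ≠ 1 → ∀ q, s.arr b q = 0

theorem prepProgram_runs {w n k : ℕ} (hn : 1 ≤ n) (hk : 1 ≤ k) (hkn : k ≤ n) (hnk : k ≤ n / k)
    (hw : (n + 2) ^ 12 ≤ 2 ^ w) (inp : ℕ → ℕ) (ω : ℕ → Bool) :
    Runs w inp ω prepProgram ⟨initVar n k, fun _ _ => 0, 0⟩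
      (6 + (100 * (Nat.clog 2 (n + 2) + 1) +
        (numRepeats n * numBlocks n k * (20 * (Nat.log 2 k + 2) + 13) + 8 +
        (numRepeats n * (k + k + 1) * numBlocks n k * 60 + 20)))) (Prepared w n k inp ω) := by
  obtain ⟨b1, b2, b3, b4, b5, b6, b7⟩ := word_bounds hn hk hkn hw
  have : Fact (64 < 2 ^ w) := ⟨by omega⟩
  refine .ite (by simp) (fun h => absurd h ?_) (fun _ => ?_)
  · simp [initVar, hnk]
  simp only [cost_less, cost_div, cost_var]
  refine .seq _ (by omega) ((setup_runs hk hkn b1 (by simp [initVar]) (by simp [initVar])).mono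
    le_rfl ?_)
  rintro s₁ ⟨hs₁, hA₁, hp₁⟩
  refine .seq (numRepeats n * numBlocks n k * (20 * (Nat.log 2 k + 2) + 13) + 8) (by omega)
    ((drawSamples_runs (L := numRepeats n) (nb := numBlocks n k) b2 (by omega) hs₁ hp₁).mono
    le_rfl ?_)
  rintro s₂ ⟨hs₂, hA₂, hU₂⟩
  refine (hashB_runs (L := numRepeats n) (nb := numBlocks n k) hs₂ hU₂ ?_ (by omega) (by omega)
    (by omega)).mono (by omega) ?_
  · rw [hA₂ 1 (by omega), hA₁]
  rintro s₃ ⟨hA₃, hH₃⟩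
  refine ⟨fun q hq => ?_, hH₃, fun b h0 h1 q => ?_⟩
  · rw [hA₃ 0 (by omega), hU₂ q hq]
  · rw [hA₃ b h1, hA₂ b h0, hA₁]

theorem sample_lt (ω : ℕ → Bool) (a q : ℕ) : sample ω (a + 1) q < 2 * 2 ^ a := by
  rw [← pow_succ']
  exact ofDigits_lt _ _

/-- The query program fills a table that satisfies the recurrence, with tests that are passed by
all pairs of equal segments, and only if the samples agree. -/
theorem queryProgram_runs {w n k : ℕ} (hn : 1 ≤ n) (hk : 1 ≤ k) (hkn : k ≤ n) (hnk : k ≤ n / k)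
    (hw : (n + 2) ^ 12 ≤ 2 ^ w) (inp inpB : ℕ → ℕ) (ω : ℕ → Bool) {s : Store}
    (hs : Prepared w n k inpB ω s) :
    Runs w inp ω queryProgram ⟨initVar n k, s.arr, s.pos⟩
      (6 + (100 * (Nat.clog 2 (n + 2) + 1) + (numRepeats n * numBlocks n k * 40 + 20 +
        ((k + 1) * (k + k + 1 + 1) *
          ((Nat.clog 2 (n + 2) + 2) * (numRepeats n * 110 + 60) + 100) + 20 + 20))))
      (fun s' => ∃ (P : ℕ → ℕ → ℕ → Prop) (T : ℕ → ℕ), IsTable P n k T ∧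
        s'.var 0 = (if T ((k + 1) * (k + k + 2) + (k + 1)) = n then 1 else 0) ∧
        (∀ d < k + k + 1, ∀ x z, x ≤ z → z ≤ n →
          (∀ t, x ≤ t → t < z → inp t = shifted w k inpB (t + d)) → P d x z) ∧
        ∀ d < k + k + 1, ∀ x z, x ≤ z → z ≤ n → P d x z → ∀ j < numRepeats n,
          ∑ β ∈ Finset.range (numBlocks n k),
            sampleDiff w (2 ^ Nat.log 2 k) inp (shifted w k inpB) d x z β
              (sample ω (Nat.log 2 k + 1) (j * numBlocks n k + β)) = 0) := by
  obtain ⟨b1, b2, b3, b4, b5, b6, b7⟩ := word_bounds hn hk hkn hw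
  obtain ⟨l1, -, -, -⟩ := clog_bounds n
  have : Fact (64 < 2 ^ w) := ⟨by omega⟩
  have hK : 0 < 2 ^ Nat.log 2 k := by positivity
  have hnb : n / 2 ^ Nat.log 2 k < numBlocks n k := Nat.lt_succ_self _
  refine .ite (by simp) (fun h => absurd h ?_) (fun _ => ?_)
  · simp [initVar, hnk]
  simp only [cost_less, cost_div, cost_var]
  refine .seq _ (by omega) ((setup_runs hk hkn b1 (by simp [initVar]) (by simp [initVar])).mono
    le_rfl ?_)
  rintro s₁ ⟨hs₁, hA₁, hp₁⟩
  refine .seq (numRepeats n * numBlocks n k * 40 + 20) (by omega) ((hashA_runs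
    (L := numRepeats n) (nb := numBlocks n k) (u := sample ω (Nat.log 2 k + 1)) hs₁ ?_
    (sample_lt ω _) ?_ (by omega) (by omega)).mono le_rfl ?_)
  · intro q hq
    rw [hA₁, hs.samples q hq]
  · rw [hA₁, hs.zero 2 (by omega) (by omega)]
  rintro s₂ ⟨hs₂, hA₂, hH₂⟩
  refine .seq ((k + 1) * (k + k + 1 + 1) *
      ((Nat.clog 2 (n + 2) + 2) * (numRepeats n * 110 + 60) + 100) + 20) (by omega)
    ((fillTable_runs (L := numRepeats n) (nb := numBlocks n k) hs₂ ?_ hnb b3 b4 (by omega)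
      (by omega) b5 b6).mono le_rfl ?_)
  · intro q
    rw [hA₂ 3 (by omega), hA₁, hs.zero 3 (by omega) (by omega)]
  rintro s₃ ⟨hs₃, hz₃, hT₃⟩
  have hu : ∀ q < numRepeats n * numBlocks n k, s₂.arr 0 q = sample ω (Nat.log 2 k + 1) q := by
    intro q hq
    rw [hA₂ 0 (by omega), hA₁, hs.samples q hq]
  have hB : ∀ q ≤ numRepeats n * (k + k + 1) * numBlocks n k, s₂.arr 1 q =
      (∑ p ∈ Finset.range q, termB (shifted w k inpB) (2 ^ Nat.log 2 k) (k + k + 1)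
        (numBlocks n k) (sample ω (Nat.log 2 k + 1)) p) % 2 ^ w := by
    intro q hq
    rw [hA₂ 1 (by omega), hA₁, hs.hash q hq]
  refine .assign (by simp) ⟨AgreeAll w (2 ^ Nat.log 2 k) (numRepeats n) (numBlocks n k)
    (k + k + 1) (s₂.arr 0) (s₂.arr 2) (s₂.arr 1), s₃.arr 3, ⟨hz₃, hT₃⟩, ?_, ?_, ?_⟩
  · have e : (k + 2) * (k + k + 1 + 1) = (k + 1) * (k + k + 1 + 1) + (k + k + 1 + 1) := by ring
    simp [hs₃.r0, hs₃.r1, hs₃.r6]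
    rw [Nat.mod_eq_of_lt (by omega)]
  · intro d hd x z hxz hz hm
    exact agreeAll_of_match hK hu hH₂ hB hd hxz ((Nat.div_le_div_right hz).trans_lt hnb) hm
  · intro d hd x z hxz hz hP j hj
    exact (agree_iff hK hu hH₂ hB hj hd hxz ((Nat.div_le_div_right hz).trans_lt hnb)).1 (hP j hj)

end GapEdit

namespace GapEdit

/-! ### Strings and their code words -/

section Strings

variable {α : Type*} {w n k : ℕ}

theorem inputOf_lt (code : α ↪ Fin (2 ^ w)) (X : Fin n → α) (i : ℕ) : inputOf code X i < 2 ^ w := by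
  unfold inputOf
  split_ifs
  · exact (code _).2
  · positivity

theorem shifted_inputOf (hk : k < 2 ^ w) (hn : n ≤ 2 ^ w) (code : α ↪ Fin (2 ^ w)) (X : Fin n → α)
    {i : ℕ} (hi : i < n) : shifted w k (inputOf code X) (k + i) = inputOf code X i := by
  rw [shifted, show k + i + (2 ^ w - k) = i + 2 ^ w by omega, Nat.add_mod_right,
    Nat.mod_eq_of_lt (by omega)]

theorem segment_inputOf (code : α ↪ Fin (2 ^ w)) (X : Fin n → α) :
    segment (inputOf code X) 0 n = (List.ofFn X).map fun x => (code x : ℕ) := by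
  apply List.ext_getElem
  · simp [segment]
  · intro i h1 h2
    have hi : i < n := by simpa [segment] using h1
    simp [segment, inputOf, hi]

theorem segment_shifted (hk : k < 2 ^ w) (hn : n ≤ 2 ^ w) (code : α ↪ Fin (2 ^ w))
    (X : Fin n → α) :
    segment (shifted w k (inputOf code X)) k (n + k) =
      (List.ofFn X).map fun x => (code x : ℕ) := by
  apply List.ext_getElem
  · simp [segment]
  · intro i h1 h2
    have hi : i < n := by simpa [segment] using h1
    simp [segment, shifted_inputOf hk hn code X hi, inputOf, hi]

theorem exists_within_editDist (u v : List α) : Within (editDist u v) u v :=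
  ⟨_, le_rfl, Nat.sInf_mem (exists_editSteps u v)⟩

/-- Edit sequences are mapped forward by `f` and back by a left inverse, which exists as `α` is
nonempty. -/
theorem editDist_map {β : Type*} [Nonempty α] {f : α → β} (hf : Function.Injective f)
    (u v : List α) : editDist (u.map f) (v.map f) = editDist u v := by
  refine le_antisymm ((exists_within_editDist u v).map f).editDist_le ?_
  have h := ((exists_within_editDist (u.map f) (v.map f)).map (Function.invFun f)).editDist_le
  simpa [List.map_map, Function.invFun_comp hf] using h

theorem editDist_le_length (u v : List α) : editDist u v ≤ u.length + v.length := by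
  have h1 := within_append_left u ([] : List α)
  have h2 := within_append_right v ([] : List α)
  rw [List.append_nil] at h1 h2
  exact (h1.trans h2).editDist_le

end Strings

/-! ### The error probability -/

/-- Whenever the samples agree in all repetitions, there are few mismatches. -/
def SamplesReliable (w n k : ℕ) (a b : ℕ → ℕ) (ω : ℕ → Bool) : Prop :=
  ∀ d < k + k + 1, ∀ x z, x ≤ z → z ≤ n → (∀ j < numRepeats n,
    ∑ β ∈ Finset.range (numBlocks n k), sampleDiff w (2 ^ Nat.log 2 k) a b d x z β
      (sample ω (Nat.log 2 k + 1) (j * numBlocks n k + β)) = 0) →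
    mismatches a b d x z < 2 ^ Nat.log 2 k

open Finset in
theorem samplesReliable_prob {w n k : ℕ} {a b : ℕ → ℕ} (hn : 1 ≤ n) (hkn : k ≤ n)
    (ha : ∀ i, a i < 2 ^ w) (hb : ∀ i, b i < 2 ^ w) :
    1 - 1 / (n : ℝ) ≤ coinMeasure.real {ω | SamplesReliable w n k a b ω} := by
  set B : ℕ × ℕ × ℕ → Set (ℕ → Bool) := fun p => {ω | ∀ j < numRepeats n,
    ∑ β ∈ range (numBlocks n k), sampleDiff w (2 ^ Nat.log 2 k) a b p.1 p.2.1 p.2.2 β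
      (sample ω (Nat.log 2 k + 1) (j * numBlocks n k + β)) = 0} with hB
  set I : Finset (ℕ × ℕ × ℕ) := (range (k + k + 1) ×ˢ range (n + 1) ×ˢ range (n + 1)).filter
    fun p => 2 ^ Nat.log 2 k ≤ mismatches a b p.1 p.2.1 p.2.2 with hI
  -- Subadditivity on a cover of the whole space gives the lower bound without measurability of the
  -- good event.
  have hcover : Set.univ ⊆ {ω | SamplesReliable w n k a b ω} ∪ ⋃ p ∈ I, B p := by
    intro ω _
    by_contra hω
    refine hω (Or.inl fun d hd x z hxz hz h => ?_)
    by_contra hcon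
    refine hω (Or.inr ?_)
    simp only [Set.mem_iUnion]
    refine ⟨(d, x, z), ?_, h⟩
    simp only [hI, mem_filter, mem_product, mem_range]
    exact ⟨⟨hd, by omega, by omega⟩, not_lt.1 hcon⟩
  have hBp : ∀ p ∈ I, coinMeasure.real (B p) ≤ (3 / 4) ^ numRepeats n := by
    intro p hp
    simp only [hI, mem_filter, mem_product, mem_range] at hp
    refine coinMeasure_sampleDiff_le ha hb ?_ hp.2
    exact (Nat.div_le_div_right (by omega : p.2.2 ≤ n)).trans_lt (Nat.lt_succ_self _)
  have hbad : coinMeasure.real (⋃ p ∈ I, B p) ≤ 1 / n := by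
    have hcard : (#I : ℝ) ≤ 2 * (n + 2 : ℝ) ^ 3 := by
      have h1 : #I ≤ 2 * (n + 2) ^ 3 := by
        refine (card_filter_le _ _).trans ?_
        rw [card_product, card_product, card_range, card_range]
        calc (k + k + 1) * ((n + 1) * (n + 1)) ≤ 2 * (n + 2) * ((n + 2) * (n + 2)) :=
              Nat.mul_le_mul (by omega) (Nat.mul_le_mul (by omega) (by omega))
          _ = 2 * (n + 2) ^ 3 := by ring
      exact_mod_cast h1
    -- The factor 16 in the number of repetitions is chosen so that `(3 / 4) ^ 16 ≤ (1 / 2) ^ 5`,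
    -- which beats the cubic number of diagonals and segments.
    have hpow : (3 / 4 : ℝ) ^ numRepeats n ≤ 1 / (n + 2 : ℝ) ^ 5 := by
      have h2 : (n + 2 : ℝ) ≤ 2 ^ Nat.clog 2 (n + 2) := by exact_mod_cast (clog_bounds n).1
      calc (3 / 4 : ℝ) ^ numRepeats n = ((3 / 4) ^ 16) ^ Nat.clog 2 (n + 2) := by
            rw [numRepeats, pow_mul]
        _ ≤ ((1 / 2) ^ 5) ^ Nat.clog 2 (n + 2) :=
            pow_le_pow_left₀ (by positivity) (by norm_num) _
        _ = 1 / (2 ^ Nat.clog 2 (n + 2)) ^ 5 := by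
            rw [← pow_mul, ← pow_mul, mul_comm, one_div_pow]
        _ ≤ 1 / (n + 2 : ℝ) ^ 5 :=
            one_div_le_one_div_of_le (by positivity) (pow_le_pow_left₀ (by positivity) h2 5)
    have hn' : (1 : ℝ) ≤ n := by exact_mod_cast hn
    refine (MeasureTheory.measureReal_biUnion_finset_le _ _).trans
      ((sum_le_card_nsmul _ _ _ hBp).trans ?_)
    rw [nsmul_eq_mul]
    calc (#I : ℝ) * (3 / 4) ^ numRepeats n ≤ 2 * (n + 2 : ℝ) ^ 3 * (1 / (n + 2 : ℝ) ^ 5) :=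
          mul_le_mul hcard hpow (by positivity) (by positivity)
      _ = 2 / (n + 2 : ℝ) ^ 2 := by field_simp
      _ ≤ 1 / n := by
          rw [div_le_div_iff₀ (by positivity) (by positivity)]
          nlinarith
  have h1 := MeasureTheory.measureReal_mono (μ := coinMeasure) hcover
    (MeasureTheory.measure_ne_top _ _)
  rw [MeasureTheory.probReal_univ] at h1
  have h2 := MeasureTheory.measureReal_union_le (μ := coinMeasure)
    {ω | SamplesReliable w n k a b ω} (⋃ p ∈ I, B p)
  linarith

/-! ### Running times -/

theorem one_le_log {n : ℕ} (hn : 1 ≤ n) : 1 ≤ Real.log (n + 2) := by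
  rw [Real.le_log_iff_exp_le (by positivity)]
  have : (1 : ℝ) ≤ n := by exact_mod_cast hn
  linarith [Real.exp_one_lt_d9]

theorem clog_le_log {n : ℕ} (hn : 1 ≤ n) : (Nat.clog 2 (n + 2) : ℝ) ≤ 3 * Real.log (n + 2) := by
  have h0 := one_le_log hn
  have h1 : (2 : ℝ) ^ Nat.clog 2 (n + 2) ≤ 2 * (n + 2) := by exact_mod_cast (clog_bounds n).2.1.le
  have h2 := Real.log_le_log (by positivity) h1
  rw [Real.log_pow, Real.log_mul (by norm_num) (by positivity)] at h2
  have h3 := Real.log_two_gt_d9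
  have h4 : (0 : ℝ) ≤ Nat.clog 2 (n + 2) := Nat.cast_nonneg _
  have h5 := Real.log_two_lt_d9
  nlinarith

theorem clog_sq_le {n C : ℕ} (hn : 1 ≤ n) (hC : 2 ≤ C) :
    (Nat.clog 2 (n + 2) : ℝ) ^ 2 ≤ 9 * Real.log (n + 2) ^ C := by
  have h0 := one_le_log hn
  calc (Nat.clog 2 (n + 2) : ℝ) ^ 2 ≤ (3 * Real.log (n + 2)) ^ 2 :=
        pow_le_pow_left₀ (Nat.cast_nonneg _) (clog_le_log hn) 2
    _ = 9 * Real.log (n + 2) ^ 2 := by ring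
    _ ≤ 9 * Real.log (n + 2) ^ C :=
        mul_le_mul_of_nonneg_left (pow_le_pow_right₀ h0 hC) (by norm_num)

theorem log_le_clog' {n k : ℕ} (hkn : k ≤ n) : Nat.log 2 k ≤ Nat.clog 2 (n + 2) :=
  (Nat.log_mono_right (by omega)).trans (Nat.log_le_clog 2 (n + 2))

theorem numBlocks_mul_le {n k : ℕ} (hk : 1 ≤ k) : k * numBlocks n k ≤ 2 * n + k := by
  have h1 := Nat.div_mul_le_self n (2 ^ Nat.log 2 k)
  have h2 := (block_bounds hk).2
  unfold numBlocks
  nlinarith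

/-- As `k < 2 * K`, the product of `k` and the number of blocks is linear in `n`. The repetitions
contribute one logarithm, and drawing a number bit by bit another one. -/
theorem prep_time {n k C : ℕ} (hn : 1 ≤ n) (hk : 1 ≤ k) (hkn : k ≤ n) (hC : 1000000 ≤ C) :
    ((6 + (100 * (Nat.clog 2 (n + 2) + 1) +
        (numRepeats n * numBlocks n k * (20 * (Nat.log 2 k + 2) + 13) + 8 +
        (numRepeats n * (k + k + 1) * numBlocks n k * 60 + 20))) : ℕ) : ℝ) ≤
      C * n * Real.log (n + 2) ^ C := by
  have hl1 := (clog_bounds n).2.2.1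
  have hal := log_le_clog' hkn
  have hb := numBlocks_mul_le (n := n) hk
  have hL : numRepeats n = 16 * Nat.clog 2 (n + 2) := rfl
  have hsq := clog_sq_le (C := C) hn (by omega)
  set l := Nat.clog 2 (n + 2)
  have hb1 : numBlocks n k ≤ 3 * n := by
    have := Nat.le_mul_of_pos_left (numBlocks n k) hk
    have := Nat.div_le_self n (2 ^ Nat.log 2 k)
    unfold numBlocks
    omega
  have hb2 : (k + k + 1) * numBlocks n k ≤ 9 * n := by
    have : (k + k + 1) * numBlocks n k = 2 * (k * numBlocks n k) + numBlocks n k := by ring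
    omega
  have h1 : numRepeats n * numBlocks n k * (20 * (Nat.log 2 k + 2) + 13) ≤
      16 * l * (3 * n) * (73 * l) := by
    rw [hL]
    exact Nat.mul_le_mul (Nat.mul_le_mul_left _ hb1) (by omega)
  have h2 : numRepeats n * (k + k + 1) * numBlocks n k * 60 ≤ 16 * l * (9 * n) * 60 := by
    rw [hL, mul_assoc (16 * l)]
    exact Nat.mul_le_mul_right _ (Nat.mul_le_mul_left _ hb2)
  have h3 : l ≤ n * l ^ 2 := by nlinarith [Nat.mul_le_mul hn hl1]
  have h4 : n * l ≤ n * l ^ 2 := by nlinarith [Nat.mul_le_mul hn hl1]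
  have h5 : 6 + (100 * (l + 1) +
        (numRepeats n * numBlocks n k * (20 * (Nat.log 2 k + 2) + 13) + 8 +
        (numRepeats n * (k + k + 1) * numBlocks n k * 60 + 20))) ≤ 100000 * (n * l ^ 2) := by
    nlinarith
  have h6 : ((100000 * (n * l ^ 2) : ℕ) : ℝ) ≤ C * n * Real.log (n + 2) ^ C := by
    push_cast
    have hC' : (1000000 : ℝ) ≤ C := by exact_mod_cast hC
    have hp : (0 : ℝ) ≤ Real.log (n + 2) ^ C := pow_nonneg (by linarith [one_le_log hn]) C
    have hn0 : (0 : ℝ) ≤ n := Nat.cast_nonneg n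
    calc (100000 * (n * l ^ 2) : ℝ) ≤ 100000 * (n * (9 * Real.log (n + 2) ^ C)) := by gcongr
      _ = 900000 * (n * Real.log (n + 2) ^ C) := by ring
      _ ≤ C * (n * Real.log (n + 2) ^ C) :=
          mul_le_mul_of_nonneg_right (by linarith) (by positivity)
      _ = _ := by ring
  exact le_trans (by exact_mod_cast h5) h6

/-- There are at most `2 * n / k + 1` blocks and about `2 * k ^ 2` table cells; a cell takes a
logarithmic number of jumps, each tested in logarithmically many repetitions. -/
theorem query_time {n k C : ℕ} (hn : 1 ≤ n) (hk : 1 ≤ k) (hC : 1000000 ≤ C) :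
    ((6 + (100 * (Nat.clog 2 (n + 2) + 1) + (numRepeats n * numBlocks n k * 40 + 20 +
        ((k + 1) * (k + k + 1 + 1) *
          ((Nat.clog 2 (n + 2) + 2) * (numRepeats n * 110 + 60) + 100) + 20 + 20))) : ℕ) : ℝ) ≤
      C * ((n : ℝ) / k + (k : ℝ) ^ 2) * Real.log (n + 2) ^ C := by
  have hl1 := (clog_bounds n).2.2.1
  have hb := numBlocks_mul_le (n := n) hk
  have hL : numRepeats n = 16 * Nat.clog 2 (n + 2) := rfl
  have hsq := clog_sq_le (C := C) hn (by omega)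
  set l := Nat.clog 2 (n + 2)
  have hk' : (1 : ℝ) ≤ k := by exact_mod_cast hk
  have hl' : (1 : ℝ) ≤ l := by exact_mod_cast hl1
  have hnb : (numBlocks n k : ℝ) ≤ 2 * (n / k) + k ^ 2 := by
    have h1 : (k : ℝ) * numBlocks n k ≤ 2 * n + k := by exact_mod_cast hb
    have h2 : (numBlocks n k : ℝ) ≤ (2 * n + k) / k := by
      rw [le_div_iff₀ (by linarith)]
      linarith
    have h3 : (2 * n + k : ℝ) / k = 2 * (n / k) + 1 := by field_simp
    nlinarith
  have hE0 : (0 : ℝ) ≤ n / k := by positivity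
  set E : ℝ := n / k + k ^ 2 with hE
  have hE1 : (k : ℝ) ^ 2 ≤ E := by linarith
  have hE2 : 1 ≤ E := by nlinarith
  have hll : (l : ℝ) ≤ l ^ 2 := by nlinarith
  have hnb' : (l : ℝ) * numBlocks n k ≤ l ^ 2 * (2 * E) :=
    mul_le_mul hll (by linarith [sq_nonneg (k : ℝ)]) (Nat.cast_nonneg _) (by positivity)
  have hcells : ((k : ℝ) + 1) * (k + k + 1 + 1) ≤ 8 * E := by nlinarith
  have hcell : ((l : ℝ) + 2) * (16 * l * 110 + 60) + 100 ≤ 6000 * l ^ 2 := by nlinarith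
  have htable : ((k : ℝ) + 1) * (k + k + 1 + 1) * ((l + 2) * (16 * l * 110 + 60) + 100) ≤
      8 * E * (6000 * l ^ 2) := mul_le_mul hcells hcell (by positivity) (by linarith)
  have hEl : (l : ℝ) ≤ E * l ^ 2 := hll.trans (le_mul_of_one_le_left (by positivity) hE2)
  have h5 : ((6 + (100 * (l + 1) + (numRepeats n * numBlocks n k * 40 + 20 +
        ((k + 1) * (k + k + 1 + 1) *
          ((l + 2) * (numRepeats n * 110 + 60) + 100) + 20 + 20))) : ℕ) : ℝ) ≤
      100000 * (E * l ^ 2) := by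
    rw [hL]
    push_cast
    nlinarith
  refine h5.trans ?_
  have hC' : (1000000 : ℝ) ≤ C := by exact_mod_cast hC
  have hp : (0 : ℝ) ≤ Real.log (n + 2) ^ C := pow_nonneg (by linarith [one_le_log hn]) C
  have hE3 : 0 ≤ E := by linarith
  calc (100000 * (E * l ^ 2) : ℝ) ≤ 100000 * (E * (9 * Real.log (n + 2) ^ C)) := by gcongr
    _ = 900000 * (E * Real.log (n + 2) ^ C) := by ring
    _ ≤ C * (E * Real.log (n + 2) ^ C) :=
        mul_le_mul_of_nonneg_right (by linarith) (by positivity)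
    _ = _ := by ring

/-! ### Correctness -/

theorem session_of_large {α : Type*} {w n k C : ℕ} (hn : 1 ≤ n) (hk : 1 ≤ k) (hC : 1000000 ≤ C)
    (hw : (n + 2) ^ 12 ≤ 2 ^ w) (hnk : n / k < k) (code : α ↪ Fin (2 ^ w)) (A B : Fin n → α)
    (ω : ℕ → Bool) :
    ∃ t₁ t₂ out : ℕ, Session prepProgram queryProgram n k code A B ω t₁ t₂ out ∧
      (t₁ : ℝ) ≤ C * n * Real.log (n + 2) ^ C ∧
      (t₂ : ℝ) ≤ C * ((n : ℝ) / k + (k : ℝ) ^ 2) * Real.log (n + 2) ^ C ∧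
      (editDist (List.ofFn A) (List.ofFn B) ≤ k → out = 1) ∧
      (3 * k ^ 2 < editDist (List.ofFn A) (List.ofFn B) → out = 0) := by
  have hw' : 64 < 2 ^ w := lt_of_lt_of_le (by norm_num)
    ((Nat.pow_le_pow_left (show 3 ≤ n + 2 by omega) 12).trans hw)
  have : Fact (64 < 2 ^ w) := ⟨hw'⟩
  obtain ⟨t₁, s₁, h₁, ht₁, -⟩ : Runs w (inputOf code B) ω prepProgram
      ⟨initVar n k, fun _ _ => 0, 0⟩ 7 (fun _ => True) := by
    refine .ite (by simp) (fun _ => .skip (by simp) trivial) (fun h => ?_)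
    simp [initVar, not_le.2 hnk] at h
  obtain ⟨t₂, s₂, h₂, ht₂, hout⟩ : Runs w (inputOf code A) ω queryProgram
      ⟨initVar n k, s₁.arr, s₁.pos⟩ 8 (fun s => s.var 0 = 1) := by
    refine .ite (by simp) (fun _ => .assign (by simp) (by simp)) (fun h => ?_)
    simp [initVar, not_le.2 hnk] at h
  have hC' : (1000000 : ℝ) ≤ C := by exact_mod_cast hC
  have hp : (1 : ℝ) ≤ Real.log (n + 2) ^ C := one_le_pow₀ (one_le_log hn)
  have hn' : (1 : ℝ) ≤ n := by exact_mod_cast hn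
  have hk' : (1 : ℝ) ≤ k := by exact_mod_cast hk
  have ht₁' : (t₁ : ℝ) ≤ 7 := by exact_mod_cast ht₁
  have ht₂' : (t₂ : ℝ) ≤ 8 := by exact_mod_cast ht₂
  refine ⟨t₁, t₂, 1, ⟨s₁, s₂, h₁, h₂, hout⟩, ?_, ?_, fun _ => rfl, fun h => absurd h (not_lt.2 ?_)⟩
  · have : (8 : ℝ) * 1 * 1 ≤ C * n * Real.log (n + 2) ^ C := by gcongr; linarith
    linarith
  · have hE : (1 : ℝ) ≤ n / k + k ^ 2 := by
      have : (0 : ℝ) ≤ n / k := by positivity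
      nlinarith
    have : (8 : ℝ) * 1 * 1 ≤ C * ((n : ℝ) / k + (k : ℝ) ^ 2) * Real.log (n + 2) ^ C := by
      gcongr; linarith
    linarith
  · have h1 := editDist_le_length (List.ofFn A) (List.ofFn B)
    have h2 : n < k * k := (Nat.div_lt_iff_lt_mul hk).1 hnk
    simp only [List.length_ofFn] at h1
    nlinarith

theorem session_of_small {α : Type*} {w n k C : ℕ} (hn : 1 ≤ n) (hk : 1 ≤ k) (hC : 1000000 ≤ C)
    (hw : (n + 2) ^ 12 ≤ 2 ^ w) (hnk : k ≤ n / k) (code : α ↪ Fin (2 ^ w)) (A B : Fin n → α)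
    (ω : ℕ → Bool) :
    ∃ t₁ t₂ out : ℕ, Session prepProgram queryProgram n k code A B ω t₁ t₂ out ∧
      (t₁ : ℝ) ≤ C * n * Real.log (n + 2) ^ C ∧
      (t₂ : ℝ) ≤ C * ((n : ℝ) / k + (k : ℝ) ^ 2) * Real.log (n + 2) ^ C ∧
      (SamplesReliable w n k (inputOf code A) (shifted w k (inputOf code B)) ω →
        (editDist (List.ofFn A) (List.ofFn B) ≤ k → out = 1) ∧
        (3 * k ^ 2 < editDist (List.ofFn A) (List.ofFn B) → out = 0)) := by
  have hkn : k ≤ n := hnk.trans (Nat.div_le_self _ _)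
  have hnw : 64 * (n + 2) < 2 ^ w := (word_bounds hn hk hkn hw).1
  obtain ⟨t₁, s₁, h₁, ht₁, hprep⟩ := prepProgram_runs hn hk hkn hnk hw (inputOf code B) ω
  obtain ⟨t₂, s₂, h₂, ht₂, P, T, hT, hout, hmatch, hagree⟩ :=
    queryProgram_runs hn hk hkn hnk hw (inputOf code A) (inputOf code B) ω hprep
  have : Nonempty α := ⟨A ⟨0, hn⟩⟩
  have hinj : Function.Injective fun x => (code x : ℕ) :=
    Fin.val_injective.comp code.injective
  have hED : editDist (segment (inputOf code A) 0 n)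
      (segment (shifted w k (inputOf code B)) k (n + k)) =
      editDist (List.ofFn A) (List.ofFn B) := by
    rw [segment_inputOf, segment_shifted (by omega) (by omega), editDist_map hinj]
  refine ⟨t₁, t₂, _, ⟨s₁, s₂, h₁, h₂, hout⟩,
    le_trans (by exact_mod_cast ht₁) (prep_time hn hk hkn hC),
    le_trans (by exact_mod_cast ht₂) (query_time hn hk hC), fun hrel => ⟨fun h => ?_, fun h => ?_⟩⟩
  · rw [← hED] at h
    exact if_pos (hT.complete hmatch h)
  · refine if_neg fun hend => not_le.2 h ?_
    rw [← hED]
    refine (hT.sound (fun d hd x z hxz hz hP =>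
      hrel d hd x z hxz hz (hagree d hd x z hxz hz hP)) hend).editDist_le.trans ?_
    have hK := (block_bounds hk).1
    -- `(k + 1) * K + k ≤ k ^ 2 + 2 * k ≤ 3 * k ^ 2`, by `K ≤ k` and `1 ≤ k`.
    nlinarith [Nat.mul_le_mul_left (k + 1) hK]

theorem programs_correct {α : Type*} {w n k C : ℕ} (hn : 1 ≤ n) (hk : 1 ≤ k) (hC : 1000000 ≤ C)
    (hw : (n + 2) ^ C ≤ 2 ^ w) (code : α ↪ Fin (2 ^ w)) (A B : Fin n → α) :
    (∀ ω : ℕ → Bool, ∃ t₁ t₂ out : ℕ,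
      Session prepProgram queryProgram n k code A B ω t₁ t₂ out ∧
      (t₁ : ℝ) ≤ C * n * Real.log (n + 2) ^ C ∧
      (t₂ : ℝ) ≤ C * ((n : ℝ) / k + (k : ℝ) ^ 2) * Real.log (n + 2) ^ C) ∧
    1 - 1 / (n : ℝ) ≤ coinMeasure.real
      {ω | ∃ t₁ t₂ out : ℕ,
        Session prepProgram queryProgram n k code A B ω t₁ t₂ out ∧
        (editDist (List.ofFn A) (List.ofFn B) ≤ k → out = 1) ∧
        (3 * k ^ 2 < editDist (List.ofFn A) (List.ofFn B) → out = 0)} := by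
  have hw' : (n + 2) ^ 12 ≤ 2 ^ w :=
    (Nat.pow_le_pow_right (by omega) ((by norm_num : 12 ≤ 1000000).trans hC)).trans hw
  rcases Nat.lt_or_ge (n / k) k with hnk | hnk
  · have H := session_of_large hn hk hC hw' hnk code A B
    constructor
    · intro ω
      obtain ⟨t₁, t₂, out, h, h₁, h₂, -⟩ := H ω
      exact ⟨t₁, t₂, out, h, h₁, h₂⟩
    · refine le_trans ?_ (MeasureTheory.measureReal_mono (s₁ := Set.univ) (fun ω _ => ?_)
        (MeasureTheory.measure_ne_top _ _))
      · rw [MeasureTheory.probReal_univ]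
        have : (0 : ℝ) ≤ 1 / n := by positivity
        linarith
      · obtain ⟨t₁, t₂, out, h, -, -, h'⟩ := H ω
        exact ⟨t₁, t₂, out, h, h'⟩
  · have H := session_of_small hn hk hC hw' hnk code A B
    constructor
    · intro ω
      obtain ⟨t₁, t₂, out, h, h₁, h₂, -⟩ := H ω
      exact ⟨t₁, t₂, out, h, h₁, h₂⟩
    · refine (samplesReliable_prob (b := shifted w k (inputOf code B)) hn
        (hnk.trans (Nat.div_le_self _ _)) (inputOf_lt code A) (fun i => inputOf_lt code B _)).trans (MeasureTheory.measureReal_mono (fun ω hω => ?_)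
        (MeasureTheory.measure_ne_top _ _))
      obtain ⟨t₁, t₂, out, h, -, -, h'⟩ := H ω
      exact ⟨t₁, t₂, out, h, h' hω⟩

end GapEdit
theorem theorem3 :
    ∃ (prep query : GapEdit.Cmd) (C : ℕ),
      ∀ (w n k : ℕ), 1 ≤ n → 1 ≤ k → (n + 2) ^ C ≤ 2 ^ w → k < 2 ^ w →
      ∀ (α : Type*) (code : α ↪ Fin (2 ^ w)) (A B : Fin n → α),
        (∀ ω : ℕ → Bool, ∃ t₁ t₂ out : ℕ,
          GapEdit.Session prep query n k code A B ω t₁ t₂ out ∧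
          (t₁ : ℝ) ≤ C * n * Real.log (n + 2) ^ C ∧
          (t₂ : ℝ) ≤ C * ((n : ℝ) / k + (k : ℝ) ^ 2) * Real.log (n + 2) ^ C) ∧
        1 - 1 / (n : ℝ) ≤ GapEdit.coinMeasure.real
          {ω | ∃ t₁ t₂ out : ℕ,
            GapEdit.Session prep query n k code A B ω t₁ t₂ out ∧
            (GapEdit.editDist (List.ofFn A) (List.ofFn B) ≤ k → out = 1) ∧
            (3 * k ^ 2 < GapEdit.editDist (List.ofFn A) (List.ofFn B) → out = 0)} := by
  -- The constant exceeds the factor 900000 in both running times, the exponent 2 of the logarithm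
  -- and the exponent 12 required of the word size.
  refine ⟨GapEdit.prepProgram, GapEdit.queryProgram, 1000000, ?_⟩
  intro w n k hn hk hw _ α code A B
  exact GapEdit.programs_correct hn hk le_rfl hw code A B
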